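/- Let $n\ge 1$, $m\ge 1$, let $X$ be a set of $n$ inputs and $O$ a set of $m$ outputs. Let $\mathcal G$ be a game with rule function $\lambda: X\times X\times O\times O\to\{0,1\}$ and let $\Gamma=(\gamma_{x,y})_{x,y\in X}$ be a probability distribution on pairs of inputs: $\gamma_{x,y}\ge 0$, $\sum_{x,y}\gamma_{x,y}=1$. A projective measurement system on a Hilbert space $H$ is a family of projections $(E_{x,a})_{x\in X,a\in O}$ on $H$ with $\sum_a E_{x,a}=I$ for every $x$. Let $C_{qc}(n,m)$ be the set of all families $p(a,b|x,y)=\langle E_{x,a}F_{y,b}\psi,\psi\rangle$, where $(E_{x,a})$ and $(F_{y,b})$ are projective measurement systems on a Hilbert space $H$ with $E_{x,a}F_{y,b}=F_{y,b}E_{x,a}$ for all $x,y,a,b$, and $\psi\in H$ is a unit vector. Let $C_{loc}(n,m)$ be the subset of those $p$ that arise in this way with all the operators $E_{x,a},F_{y,b}$ commuting with each other. Let $C_q(n,m)$ be the set of all families $p(a,b|x,y)=\langle (E_{x,a}\otimes F_{y,b})\psi,\psi\rangle$, where $(E_{x,a})$ and $(F_{y,b})$ are projective measurement systems on finite dimensional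 Hilbert spaces $H_A$ and $H_B$, respectively, and $\psi\in H_A\otimes H_B$ is a unit vector. For $t\in\{loc,q,qc\}$ let $C^s_t(n,m)$ be the set of synchronous elements of $C_t(n,m)$, i.e. those with $p(a,b|x,x)=0$ for all $x$ and all $a\neq b$, and let \[ \omega^s_t(\mathcal G,\Gamma)=\sup\Big\{\sum_{x,y\in X,\;i,j\in O}\gamma_{x,y}\,\lambda(x,y,i,j)\,p(i,j|x,y)\;:\;\big(p(i,j|x,y)\big)\in C^s_t(n,m)\Big\}. \] Let $\mathbb F(n,m)$ be the free product of $n$ copies of the cyclic group $\mathbb Z_m$ of order $m$, let $C^*(\mathbb F(n,m))$ be its full group C$^*$-algebra, and let $e_{x,i}$, $i\in O$, be the minimal projections of the copy of $C^*(\mathbb Z_m)\cong\mathbb C^m$ in $C^*(\mathbb F(n,m))$ that belongs to $x\in X$. Set \[ B=\sum_{x,y\in X,\;i,j\in O}\gamma_{x,y}\,\lambda(x,y,i,j)\,e_{x,i}e_{y,j}\in C^*(\mathbb F(n,m)). \] Then $\tau(B)$ is real for every tracial state $\tau$ on $C^*(\mathbb F(n,m))$, and: 1. $\omega^s_{qc}(\mathcal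 G,\Gamma)=\sup\{\tau(B): \tau \text{ is a tracial state on } C^*(\mathbb F(n,m))\}$, and this supremum is attained. 2. $\omega^s_{q}(\mathcal G,\Gamma)=\sup\{\tau(B): \tau \text{ is a tracial state on } C^*(\mathbb F(n,m)) \text{ whose GNS representation is finite dimensional}\}$. 3. $\omega^s_{loc}(\mathcal G,\Gamma)=\sup\{\tau(B): \tau \text{ is a tracial state on } C^*(\mathbb F(n,m)) \text{ whose GNS representation has commutative image}\}$, and this supremum is attained. -/

import Mathlib

open scoped ComplexOrder TensorProduct InnerProductSpace

noncomputable section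

/-! ### The full group C⋆-algebra of a discrete group -/

/-- A unitary representation of the discrete group `G` on a complex Hilbert space. -/
structure UnitaryRep (G : Type) [Group G] where
  /-- the Hilbert space -/
  H : Type
  [normed : NormedAddCommGroup H]
  [inner : InnerProductSpace ℂ H]
  [complete : CompleteSpace H]
  /-- the action by unitaries -/
  toHom : G →* unitary (H →L[ℂ] H)

attribute [instance] UnitaryRep.normed UnitaryRep.inner UnitaryRep.complete

/-- The linear extension of a unitary representation to the group algebra `ℂ[G]`. -/
def UnitaryRep.lift {G : Type} [Group G] (ρ : UnitaryRep G) :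
    MonoidAlgebra ℂ G →ₐ[ℂ] (ρ.H →L[ℂ] ρ.H) :=
  MonoidAlgebra.lift ℂ (ρ.H →L[ℂ] ρ.H) G ((unitary (ρ.H →L[ℂ] ρ.H)).subtype.comp ρ.toHom)

/-- The group algebra `ℂ[G]`, as a type synonym that carries the involution
`(∑ c_g g)⋆ = ∑ conj(c_g) g⁻¹` and the universal C⋆-seminorm. -/
def PreGroupCStar (G : Type) [Group G] : Type := MonoidAlgebra ℂ G

namespace PreGroupCStar

variable {G : Type} [Group G]

instance : Ring (PreGroupCStar G) := inferInstanceAs (Ring (MonoidAlgebra ℂ G))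

instance : Algebra ℂ (PreGroupCStar G) := inferInstanceAs (Algebra ℂ (MonoidAlgebra ℂ G))

/-- The element `c g` of the group algebra. -/
def single (g : G) (c : ℂ) : PreGroupCStar G := MonoidAlgebra.single g c

/-- Extension of a unitary representation to the group algebra. -/
def rep (ρ : UnitaryRep G) : PreGroupCStar G →ₐ[ℂ] (ρ.H →L[ℂ] ρ.H) := ρ.lift

instance : Star (PreGroupCStar G) where
  star f := (MonoidAlgebra.coeff f).sum fun g c => single g⁻¹ (star c)

theorem induction_single {p : PreGroupCStar G → Prop} (f : PreGroupCStar G) (h0 : p 0)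
    (hadd : ∀ f g, p f → p g → p (f + g)) (hs : ∀ g c, p (single g c)) : p f :=
  MonoidAlgebra.induction_linear (motive := p) f h0 hadd hs

theorem single_mul_single (g h : G) (c d : ℂ) :
    single g c * single h d = single (g * h) (c * d) :=
  MonoidAlgebra.single_mul_single ..

theorem single_add (g : G) (c d : ℂ) : single g (c + d) = single g c + single g d :=
  MonoidAlgebra.single_add ..

theorem single_zero (g : G) : single g 0 = 0 := MonoidAlgebra.single_zero ..

theorem rep_single (ρ : UnitaryRep G) (g : G) (c : ℂ) :
    rep ρ (single g c) = c • (ρ.toHom g : ρ.H →L[ℂ] ρ.H) :=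
  MonoidAlgebra.lift_single ..

theorem star_single (g : G) (c : ℂ) : star (single g c) = single g⁻¹ (star c) := by
  change (Finsupp.single g c).sum (fun g c => single g⁻¹ (star c)) = _
  rw [Finsupp.sum_single_index]
  simp [single_zero]

theorem star_zero' : star (0 : PreGroupCStar G) = 0 :=
  Finsupp.sum_zero_index

theorem star_add' (f g : PreGroupCStar G) : star (f + g) = star f + star g := by
  change (MonoidAlgebra.coeff f + MonoidAlgebra.coeff g).sum _ = _
  rw [Finsupp.sum_add_index']
  · rfl
  · intro a; simp [single_zero]
  · intro a b c; simp [single_add]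

instance : StarRing (PreGroupCStar G) where
  star_involutive f := by
    induction f using induction_single with
    | h0 => simp [star_zero']
    | hadd f g hf hg => rw [star_add', star_add', hf, hg]
    | hs g c => simp [star_single]
  star_mul f g := by
    induction f using induction_single with
    | h0 => simp [star_zero']
    | hadd f f' hf hf' => rw [add_mul, star_add', star_add', hf, hf', mul_add]
    | hs a c =>
      induction g using induction_single with
      | h0 => simp [star_zero']
      | hadd f f' hf hf' => rw [mul_add, star_add', star_add', hf, hf', add_mul]
      | hs b d => simp [star_single, single_mul_single, mul_comm]
  star_add := star_add'

theorem smul_single (r : ℂ) (g : G) (c : ℂ) : r • single g c = single g (r * c) :=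
  MonoidAlgebra.smul_single ..

instance : StarModule ℂ (PreGroupCStar G) where
  star_smul r f := by
    induction f using induction_single with
    | h0 => simp
    | hadd f g hf hg => rw [smul_add, star_add, star_add, hf, hg, smul_add]
    | hs g c => simp [star_single, smul_single]

theorem rep_star (ρ : UnitaryRep G) (f : PreGroupCStar G) : rep ρ (star f) = star (rep ρ f) := by
  induction f using induction_single with
  | h0 => simp
  | hadd f g hf hg => rw [star_add, map_add, map_add, star_add, hf, hg]
  | hs g c =>
    rw [star_single, rep_single, rep_single, star_smul, map_inv]
    rfl

/-- The universal C⋆-seminorm `‖f‖ = sup_ρ ‖ρ(f)‖`, where `ρ` runs over all unitary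
representations of `G`. -/
def univNorm (f : PreGroupCStar G) : ℝ := ⨆ ρ : UnitaryRep G, ‖rep ρ f‖

theorem bddAbove_rep (f : PreGroupCStar G) :
    BddAbove (Set.range fun ρ : UnitaryRep G => ‖rep ρ f‖) := by
  induction f using induction_single with
  | h0 => exact ⟨0, by rintro _ ⟨ρ, rfl⟩; simp⟩
  | hadd f g hf hg =>
    obtain ⟨a, ha⟩ := hf
    obtain ⟨b, hb⟩ := hg
    refine ⟨a + b, ?_⟩
    rintro _ ⟨ρ, rfl⟩
    have h1 := ha ⟨ρ, rfl⟩
    have h2 := hb ⟨ρ, rfl⟩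
    simp only [map_add] at *
    exact (norm_add_le _ _).trans (add_le_add h1 h2)
  | hs g c =>
    refine ⟨‖c‖, ?_⟩
    rintro _ ⟨ρ, rfl⟩
    have h : ‖(ρ.toHom g : ρ.H →L[ℂ] ρ.H)‖ ≤ 1 := by
      rcases subsingleton_or_nontrivial (ρ.H →L[ℂ] ρ.H) with _ | _
      · simp [Subsingleton.elim (ρ.toHom g : ρ.H →L[ℂ] ρ.H) 0]
      · exact (CStarRing.norm_coe_unitary (ρ.toHom g)).le
    simp only [rep_single, norm_smul]
    exact mul_le_of_le_one_right (norm_nonneg c) h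

instance : Nonempty (UnitaryRep G) := ⟨{ H := ℂ, toHom := 1 }⟩

theorem rep_le (ρ : UnitaryRep G) (f : PreGroupCStar G) : ‖rep ρ f‖ ≤ univNorm f :=
  le_ciSup (bddAbove_rep f) ρ

theorem univNorm_nonneg (f : PreGroupCStar G) : 0 ≤ univNorm f :=
  Real.iSup_nonneg fun _ => norm_nonneg _

/-- The universal C⋆-seminorm as a ring seminorm. -/
def univSeminorm (G : Type) [Group G] : RingSeminorm (PreGroupCStar G) where
  toFun := univNorm
  map_zero' := by simp [univNorm]
  add_le' f g := ciSup_le fun ρ => by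
    rw [map_add]
    exact (norm_add_le _ _).trans (add_le_add (rep_le ρ f) (rep_le ρ g))
  neg' f := by simp [univNorm]
  mul_le' f g := ciSup_le fun ρ => by
    rw [map_mul]
    exact (norm_mul_le _ _).trans
      (mul_le_mul (rep_le ρ f) (rep_le ρ g) (norm_nonneg _) (univNorm_nonneg f))

instance : SeminormedRing (PreGroupCStar G) := (univSeminorm G).toSeminormedRing

theorem norm_def (f : PreGroupCStar G) : ‖f‖ = ⨆ ρ : UnitaryRep G, ‖rep ρ f‖ := rfl

instance : NormedAlgebra ℂ (PreGroupCStar G) where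
  norm_smul_le r f := ciSup_le fun ρ => by
    rw [map_smul, norm_smul]
    exact mul_le_mul_of_nonneg_left (rep_le ρ f) (norm_nonneg r)

theorem norm_star' (f : PreGroupCStar G) : ‖star f‖ = ‖f‖ := by
  simp [norm_def, rep_star]

theorem norm_mul_self_le (f : PreGroupCStar G) : ‖f‖ * ‖f‖ ≤ ‖star f * f‖ := by
  have h : ‖f‖ ≤ √‖star f * f‖ := ciSup_le fun ρ => by
    apply Real.le_sqrt_of_sq_le
    rw [sq, ← CStarRing.norm_star_mul_self, ← rep_star, ← map_mul]
    exact rep_le ρ _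
  calc ‖f‖ * ‖f‖ ≤ √‖star f * f‖ * √‖star f * f‖ :=
        mul_le_mul h h (norm_nonneg _) (Real.sqrt_nonneg _)
    _ = _ := Real.mul_self_sqrt (norm_nonneg _)

instance : NormedStarGroup (PreGroupCStar G) where
  norm_star_le f := (norm_star' f).le

end PreGroupCStar

/-- The full group C⋆-algebra `C⋆(G)` of a discrete group `G`: the (Hausdorff) completion of the
group algebra `ℂ[G]` in the universal C⋆-seminorm. -/
def GroupCStar (G : Type) [Group G] : Type := UniformSpace.Completion (PreGroupCStar G)

namespace GroupCStar

open UniformSpace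

variable {G : Type} [Group G]

instance : NormedRing (GroupCStar G) :=
  inferInstanceAs (NormedRing (Completion (PreGroupCStar G)))

instance : CompleteSpace (GroupCStar G) :=
  inferInstanceAs (CompleteSpace (Completion (PreGroupCStar G)))

instance : Algebra ℂ (GroupCStar G) :=
  inferInstanceAs (Algebra ℂ (Completion (PreGroupCStar G)))

instance : NormedAlgebra ℂ (GroupCStar G) where
  norm_smul_le r f := norm_smul_le (β := Completion (PreGroupCStar G)) r f

/-- The canonical map `ℂ[G] → C⋆(G)`. -/
def coe (f : PreGroupCStar G) : GroupCStar G := (f : Completion (PreGroupCStar G))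

theorem continuous_coe : Continuous (coe : PreGroupCStar G → GroupCStar G) :=
  Completion.continuous_coe _

theorem coe_add (f g : PreGroupCStar G) : coe (f + g) = coe f + coe g := Completion.coe_add f g

theorem coe_mul (f g : PreGroupCStar G) : coe (f * g) = coe f * coe g := Completion.coe_mul f g

theorem coe_smul (r : ℂ) (f : PreGroupCStar G) : coe (r • f) = r • coe f := Completion.coe_smul r f

theorem norm_coe (f : PreGroupCStar G) : ‖coe f‖ = ‖f‖ := Completion.norm_coe f

theorem induction_coe {p : GroupCStar G → Prop} (a : GroupCStar G) (hp : IsClosed {a | p a})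
    (ih : ∀ f : PreGroupCStar G, p (coe f)) : p a :=
  Completion.induction_on a hp ih

/-- The involution of `C⋆(G)` is the continuous extension of that of the group algebra. -/
instance : Star (GroupCStar G) where
  star := Completion.map (star : PreGroupCStar G → PreGroupCStar G)

theorem continuous_star' : Continuous (star : GroupCStar G → GroupCStar G) :=
  Completion.continuous_map

theorem star_coe (f : PreGroupCStar G) : star (coe f) = coe (star f) :=
  Completion.map_coe star_isometry.uniformContinuous f

instance : StarRing (GroupCStar G) where
  star_involutive a := by
    induction a using induction_coe with
    | hp => exact isClosed_eq (continuous_star'.comp continuous_star') continuous_id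
    | ih f => simp [star_coe]
  star_mul a b := by
    induction a using induction_coe with
    | hp =>
      exact isClosed_eq (continuous_star'.comp (continuous_id.mul continuous_const))
        (continuous_const.mul continuous_star')
    | ih f =>
      induction b using induction_coe with
      | hp =>
        exact isClosed_eq (continuous_star'.comp (continuous_const.mul continuous_id))
          (continuous_star'.mul continuous_const)
      | ih g => simp [star_coe, ← coe_mul]
  star_add a b := by
    induction a using induction_coe with
    | hp =>
      exact isClosed_eq (continuous_star'.comp (continuous_id.add continuous_const))
        (continuous_star'.add continuous_const)
    | ih f =>
      induction b using induction_coe with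
      | hp =>
        exact isClosed_eq (continuous_star'.comp (continuous_const.add continuous_id))
          (continuous_const.add continuous_star')
      | ih g => simp [star_coe, ← coe_add]

instance : StarModule ℂ (GroupCStar G) where
  star_smul r a := by
    induction a using induction_coe with
    | hp =>
      exact isClosed_eq (continuous_star'.comp (continuous_id.const_smul r))
        (continuous_star'.const_smul (star r))
    | ih f => simp [star_coe, ← coe_smul]

instance : CStarRing (GroupCStar G) where
  norm_mul_self_le a := by
    induction a using induction_coe with
    | hp =>
      exact isClosed_le (continuous_norm.mul continuous_norm)
        (continuous_norm.comp (continuous_star'.mul continuous_id))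
    | ih f =>
      rw [star_coe, ← coe_mul, norm_coe, norm_coe]
      exact PreGroupCStar.norm_mul_self_le f

instance : CStarAlgebra (GroupCStar G) where

/-- The usual order of a C⋆-algebra: `a ≤ b` iff `b - a` is a positive element. -/
instance : PartialOrder (GroupCStar G) := CStarAlgebra.spectralOrder _

instance : StarOrderedRing (GroupCStar G) := CStarAlgebra.spectralOrderedRing _

/-- The canonical unitary `u_g ∈ C⋆(G)` of a group element `g`. -/
def u (g : G) : GroupCStar G := coe (PreGroupCStar.single g 1)

end GroupCStar

/-! ### Tracial states and their GNS representations -/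

section Traces

variable {A : Type*} [CStarAlgebra A] [PartialOrder A] [StarOrderedRing A]

/-- A positive linear functional `τ` is a tracial state if `τ(1) = 1` and `τ(ab) = τ(ba)`. -/
structure IsTracialState (τ : A →ₚ[ℂ] ℂ) : Prop where
  map_one : τ 1 = 1
  map_mul_comm : ∀ a b : A, τ (a * b) = τ (b * a)

/-- The GNS representation of `τ` is finite dimensional: it acts on a finite dimensional
Hilbert space. -/
def HasFiniteDimensionalGNS (τ : A →ₚ[ℂ] ℂ) : Prop :=
  FiniteDimensional ℂ τ.GNS

/-- The GNS representation of `τ` is abelian: its image is a commutative algebra of operators. -/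
def HasAbelianGNS (τ : A →ₚ[ℂ] ℂ) : Prop :=
  ∀ a b : A, Commute (τ.gnsStarAlgHom a) (τ.gnsStarAlgHom b)

end Traces

/-! ### The C⋆-algebra of the free product of cyclic groups -/

/-- `𝔽(n,m)`: the free product of `n` copies of the cyclic group of order `m`. -/
abbrev FreeProdCyclic (n m : ℕ) : Type :=
  Monoid.CoprodI fun _ : Fin n => Multiplicative (ZMod m)

/-- The element `e_{x,i}` of `C⋆(𝔽(n,m))`: the `i`-th minimal projection of the `x`-th copy of
`C⋆(ℤ/m) ≅ ℂ^m`. If `u` is the unitary of the generator of the `x`-th copy of `ℤ/m`, it is the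
spectral projection `m⁻¹ ∑_{k ∈ ℤ/m} exp(-2πi·ik/m) u^k` of `u` for the eigenvalue
`exp(2πi·i/m)`. -/
def minProj {n m : ℕ} [NeZero m] (x : Fin n) (i : Fin m) : GroupCStar (FreeProdCyclic n m) :=
  (m : ℂ)⁻¹ • ∑ k : ZMod m, ZMod.stdAddChar (-(((i : ℕ) : ZMod m) * k)) •
    GroupCStar.u (Monoid.CoprodI.of (M := fun _ : Fin n => Multiplicative (ZMod m)) (i := x)
      (Multiplicative.ofAdd k))

/-! ### Correlations -/

/-- A family `p(a,b|x,y)`, written `p x y a b`, indexed by inputs `x, y` and outputs `a, b`. -/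
abbrev Correlation (n m : ℕ) : Type := Fin n → Fin n → Fin m → Fin m → ℝ

/-- For every input `x`, the `E_{x,a}` are (orthogonal) projections with `∑_a E_{x,a} = 1`. -/
def IsProjectiveMeasurement {n m : ℕ} {H : Type} [NormedAddCommGroup H] [InnerProductSpace ℂ H]
    [CompleteSpace H] (E : Fin n → Fin m → (H →L[ℂ] H)) : Prop :=
  (∀ x a, IsStarProjection (E x a)) ∧ ∀ x, ∑ a, E x a = 1

/-- Commuting quantum correlations `C_qc(n,m)`. (Mathlib's inner product is linear in the second
variable.) -/
def Cqc (n m : ℕ) : Set (Correlation n m) :=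
  {p | ∃ (H : Type) (_ : NormedAddCommGroup H) (_ : InnerProductSpace ℂ H) (_ : CompleteSpace H)
    (E F : Fin n → Fin m → (H →L[ℂ] H)) (ψ : H),
    IsProjectiveMeasurement E ∧ IsProjectiveMeasurement F ∧
    (∀ x y a b, Commute (E x a) (F y b)) ∧ ‖ψ‖ = 1 ∧
    ∀ x y a b, (p x y a b : ℂ) = ⟪ψ, (E x a * F y b) ψ⟫_ℂ}

/-- Quantum correlations `C_q(n,m)`: tensor products of finite dimensional Hilbert spaces. -/
def Cq (n m : ℕ) : Set (Correlation n m) :=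
  {p | ∃ (HA : Type) (_ : NormedAddCommGroup HA) (_ : InnerProductSpace ℂ HA)
    (_ : CompleteSpace HA) (_ : FiniteDimensional ℂ HA)
    (HB : Type) (_ : NormedAddCommGroup HB) (_ : InnerProductSpace ℂ HB)
    (_ : CompleteSpace HB) (_ : FiniteDimensional ℂ HB)
    (E : Fin n → Fin m → (HA →L[ℂ] HA)) (F : Fin n → Fin m → (HB →L[ℂ] HB))
    (ψ : HA ⊗[ℂ] HB),
    IsProjectiveMeasurement E ∧ IsProjectiveMeasurement F ∧ ‖ψ‖ = 1 ∧
    ∀ x y a b, (p x y a b : ℂ) =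
      ⟪ψ, TensorProduct.map (E x a : HA →ₗ[ℂ] HA) (F y b : HB →ₗ[ℂ] HB) ψ⟫_ℂ}

/-- Local (classical) correlations `C_loc(n,m)`: commuting quantum strategies for which all the
measurement operators commute. -/
def Cloc (n m : ℕ) : Set (Correlation n m) :=
  {p | ∃ (H : Type) (_ : NormedAddCommGroup H) (_ : InnerProductSpace ℂ H) (_ : CompleteSpace H)
    (E F : Fin n → Fin m → (H →L[ℂ] H)) (ψ : H),
    IsProjectiveMeasurement E ∧ IsProjectiveMeasurement F ∧
    (∀ x y a b, Commute (E x a) (F y b)) ∧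
    (∀ x y a b, Commute (E x a) (E y b)) ∧ (∀ x y a b, Commute (F x a) (F y b)) ∧ ‖ψ‖ = 1 ∧
    ∀ x y a b, (p x y a b : ℂ) = ⟪ψ, (E x a * F y b) ψ⟫_ℂ}

/-- Synchronous families: `p(a,b|x,x) = 0` for `a ≠ b`. -/
def synchronous (n m : ℕ) : Set (Correlation n m) :=
  {p | ∀ x a b, a ≠ b → p x x a b = 0}

/-! ### Games and values -/

/-- A game with inputs `Fin n` and outputs `Fin m`; `rule x y a b = false` means that the
outputs `a, b` are disallowed on the inputs `x, y`. -/
structure Game (n m : ℕ) where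
  /-- the rule function `λ` -/
  rule : Fin n → Fin n → Fin m → Fin m → Bool

/-- The rule function as a `{0,1}`-valued real function. -/
def Game.lam {n m : ℕ} (G : Game n m) (x y : Fin n) (a b : Fin m) : ℝ :=
  if G.rule x y a b then 1 else 0

/-- A probability distribution on pairs of inputs. -/
structure InputDistribution (n : ℕ) where
  /-- the probabilities `γ_{x,y}` -/
  γ : Fin n → Fin n → ℝ
  nonneg : ∀ x y, 0 ≤ γ x y
  sum_eq_one : ∑ x, ∑ y, γ x y = 1

/-- The expected payoff `∑ γ_{x,y} λ(x,y,i,j) p(i,j|x,y)` of a correlation. -/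
def payoff {n m : ℕ} (G : Game n m) (Γ : InputDistribution n) (p : Correlation n m) : ℝ :=
  ∑ x, ∑ y, ∑ i, ∑ j, Γ.γ x y * G.lam x y i j * p x y i j

/-- The synchronous value of the game for the family `C` of correlations: the supremum of the
payoff over the synchronous elements of `C`. -/
def syncValue {n m : ℕ} (C : Set (Correlation n m)) (G : Game n m) (Γ : InputDistribution n) : ℝ :=
  sSup (payoff G Γ '' (C ∩ synchronous n m))

/-- The element `B = ∑ γ_{x,y} λ(x,y,i,j) e_{x,i} e_{y,j}` of `C⋆(𝔽(n,m))`. -/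
def gameElement {n m : ℕ} [NeZero m] (G : Game n m) (Γ : InputDistribution n) :
    GroupCStar (FreeProdCyclic n m) :=
  ∑ x, ∑ y, ∑ i, ∑ j, ((Γ.γ x y * G.lam x y i j : ℝ) : ℂ) • (minProj x i * minProj y j)

end

noncomputable section

/-! ### Universal property of the group C⋆-algebra -/

namespace GroupCStar

open UniformSpace

variable {G : Type} [Group G]

/-! In each of the three classes, the numbers `τ(B)` are exactly the payoffs of the synchronous
correlations, because both are governed by the values `τ(e_{x,i} e_{y,j})`.

From strategies to traces: for a commuting strategy, synchronicity kills `E_{x,a} F_{x,b} ψ` for `a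
≠ b`, and summing over outputs gives `E_{x,a} ψ = F_{x,a} ψ`. Hence an `E_{x,a}` next to `ψ` can be
exchanged for `F_{x,a}`, moved past every word in the `E`'s and turned back into `E_{x,a}` on the
other side. So the vector state of `ψ` is a trace on the algebra generated by the `E`'s
(`isTracialState_vectorFunctional`). The universal property `IsProjectiveMeasurement.exists_rep`,
which is Fourier analysis on `ℤ/m`, makes it a tracial state of `C⋆(𝔽(n,m))`. If the `E`'s commute
its GNS image is commutative, and if the space is finite dimensional so is the GNS space.

From traces to strategies: left and right multiplications on the GNS space of a trace commute, and
the vector of `1` yields `τ(ef)`. If the GNS image is commutative, left multiplication serves both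
players. If the GNS space is finite dimensional, a genuine tensor product is needed. The trace is
written as `tr(a s²)` with `s` selfadjoint in the commutant of the represented matrices
(`StarSubalgebra.exists_sqrt_trace_density`). Then `s`, read as a vector of `ℂ^d ⊗ ℂ^d`, with `a` on
one leg and `bᵀ` on the other, reproduces `τ` (`Matrix.inner_toTensor_map`).

Attainment is weak-⋆ compactness of the set of tracial states. Commutativity of the GNS image
amounts to the vanishing of `τ` on a fixed set, which is a closed condition. No such description is
used for finite dimensional GNS spaces, where only a supremum is claimed. Reality of `τ(B)` comes
from `τ(ef) ≥ 0` for projections. -/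

theorem u_mul (g h : G) : u (g * h) = u g * u h := by
  simp [u, ← coe_mul, PreGroupCStar.single_mul_single]

theorem u_one : u (1 : G) = 1 := rfl

theorem star_u (g : G) : star (u g) = u g⁻¹ := by
  simp [u, star_coe, PreGroupCStar.star_single]

/-- The group elements as a monoid homomorphism into `C⋆(G)`. -/
def uHom (G : Type) [Group G] : G →* GroupCStar G where
  toFun := u
  map_one' := u_one
  map_mul' := u_mul

theorem continuous_rep (ρ : UnitaryRep G) : Continuous (PreGroupCStar.rep ρ).toRingHom :=
  AddMonoidHomClass.continuous_of_bound (PreGroupCStar.rep ρ).toRingHom 1 fun f => by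
    rw [one_mul]; exact PreGroupCStar.rep_le ρ f

/-- The representation of `C⋆(G)` that extends a unitary representation of `G`. -/
def extend (ρ : UnitaryRep G) : GroupCStar G →⋆ₐ[ℂ] (ρ.H →L[ℂ] ρ.H) :=
  let e : GroupCStar G →+* (ρ.H →L[ℂ] ρ.H) :=
    Completion.extensionHom (PreGroupCStar.rep ρ).toRingHom (continuous_rep ρ)
  have he : Continuous e := Completion.continuous_extension
  have hec : ∀ f, e (coe f) = PreGroupCStar.rep ρ f := fun f =>
    Completion.extensionHom_coe _ (continuous_rep ρ) f
  { toRingHom := e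
    commutes' := fun c => by
      have h1 : algebraMap ℂ (GroupCStar G) c = coe (algebraMap ℂ (PreGroupCStar G) c) := rfl
      change e (algebraMap ℂ (GroupCStar G) c) = _
      rw [h1, hec, AlgHom.commutes]
    map_star' := fun a => by
      change e (star a) = star (e a)
      induction a using induction_coe with
      | hp => exact isClosed_eq (he.comp continuous_star') (continuous_star.comp he)
      | ih f => rw [star_coe, hec, hec, PreGroupCStar.rep_star] }

theorem extend_u (ρ : UnitaryRep G) (g : G) : extend ρ (u g) = (ρ.toHom g : ρ.H →L[ℂ] ρ.H) := by
  have h : extend ρ (u g) = PreGroupCStar.rep ρ (PreGroupCStar.single g 1) :=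
    Completion.extensionHom_coe _ (continuous_rep ρ) _
  rw [h, PreGroupCStar.rep_single, one_smul]

/-- The group elements generate `C⋆(G)`. -/
theorem mem_of_forall_u_mem (S : Subalgebra ℂ (GroupCStar G))
    (hS : IsClosed (S : Set (GroupCStar G))) (hu : ∀ g, u g ∈ S) (a : GroupCStar G) : a ∈ S := by
  induction a using induction_coe with
  | hp => exact hS
  | ih f =>
    induction f using PreGroupCStar.induction_single with
    | h0 => exact S.zero_mem
    | hadd f g hf hg => rw [coe_add]; exact S.add_mem hf hg
    | hs g c =>
      have : PreGroupCStar.single g c = c • PreGroupCStar.single g 1 := by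
        rw [PreGroupCStar.smul_single, mul_one]
      rw [this, coe_smul]
      exact S.smul_mem (hu g) c

end GroupCStar

/-! ### Spectral projections of representations of a cyclic group -/

section Spectral

variable {m : ℕ} [NeZero m]

theorem Fin.natCast_zmod_bijective : Function.Bijective fun i : Fin m => ((i : ℕ) : ZMod m) := by
  refine (Fintype.bijective_iff_injective_and_card _).2 ⟨fun i j h => ?_, by simp [ZMod.card]⟩
  have h' := (ZMod.natCast_eq_natCast_iff' _ _ _).1 h
  rw [Nat.mod_eq_of_lt i.2, Nat.mod_eq_of_lt j.2] at h'
  exact Fin.ext h'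

theorem sum_stdAddChar_mul (c : ZMod m) :
    ∑ k : ZMod m, ZMod.stdAddChar (c * k) = if c = 0 then (m : ℂ) else 0 := by
  have := AddChar.sum_mulShift c (ZMod.isPrimitive_stdAddChar m)
  simp only [ZMod.card, mul_comm] at this ⊢
  rw [this]
  split_ifs <;> simp

theorem sum_fin_stdAddChar_mul (c : ZMod m) :
    ∑ i : Fin m, ZMod.stdAddChar (((i : ℕ) : ZMod m) * c) = if c = 0 then (m : ℂ) else 0 := by
  rw [← sum_stdAddChar_mul]
  exact Fintype.sum_bijective _ Fin.natCast_zmod_bijective _ _ fun i => by rw [mul_comm]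

variable {A : Type*} [Ring A] [Algebra ℂ A]

/-- The spectral projection of a representation `U` of `ℤ/m` for the `i`-th character. -/
def spectralProj (U : Multiplicative (ZMod m) →* A) (i : Fin m) : A :=
  (m : ℂ)⁻¹ • ∑ k : ZMod m, ZMod.stdAddChar (-(((i : ℕ) : ZMod m) * k)) •
    U (Multiplicative.ofAdd k)

/-- Translating the summation variable by `l` only changes the character by a constant: `U(l)` acts
on the spectral projection as a scalar. Idempotence follows from this. -/
theorem spectralProj_mul_apply (U : Multiplicative (ZMod m) →* A) (i : Fin m) (l : ZMod m) :
    spectralProj U i * U (Multiplicative.ofAdd l) =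
      ZMod.stdAddChar (((i : ℕ) : ZMod m) * l) • spectralProj U i := by
  simp only [spectralProj, smul_mul_assoc, Finset.sum_mul, ← map_mul, ← ofAdd_add, Finset.smul_sum,
    smul_smul]
  refine Fintype.sum_equiv (Equiv.addRight l) _ _ fun k => ?_
  simp only [Equiv.coe_addRight]
  congr 1
  rw [mul_left_comm, ← AddChar.map_add_eq_mul]
  congr 2
  ring

theorem spectralProj_mul_self (U : Multiplicative (ZMod m) →* A) (i : Fin m) :
    spectralProj U i * spectralProj U i = spectralProj U i := by
  have hm : (m : ℂ) ≠ 0 := Nat.cast_ne_zero.2 (NeZero.ne m)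
  conv_lhs => rhs; rw [spectralProj]
  simp only [mul_smul_comm, Finset.mul_sum, spectralProj_mul_apply, smul_smul,
    ← AddChar.map_add_eq_mul, neg_add_cancel, AddChar.map_zero_eq_one, one_smul, Finset.sum_const,
    Finset.card_univ, ZMod.card, ← Nat.cast_smul_eq_nsmul ℂ, inv_mul_cancel₀ hm]

/-- Fourier inversion on `ℤ/m`. The case `l = 0` says that the projections sum to `1`; general `l`
shows that they generate the image of `U`. -/
theorem sum_smul_spectralProj (U : Multiplicative (ZMod m) →* A) (l : ZMod m) :
    ∑ i : Fin m, ZMod.stdAddChar (((i : ℕ) : ZMod m) * l) • spectralProj U i =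
      U (Multiplicative.ofAdd l) := by
  have hm : (m : ℂ) ≠ 0 := Nat.cast_ne_zero.2 (NeZero.ne m)
  simp only [spectralProj, Finset.smul_sum, smul_smul]
  rw [Finset.sum_comm]
  have : ∀ k : ZMod m, ∑ i : Fin m, (ZMod.stdAddChar (((i : ℕ) : ZMod m) * l) *
      ((m : ℂ)⁻¹ * ZMod.stdAddChar (-(((i : ℕ) : ZMod m) * k)))) • U (Multiplicative.ofAdd k) =
      if k = l then U (Multiplicative.ofAdd l) else 0 := fun k => by
    rw [← Finset.sum_smul]
    have : ∀ i : Fin m, ZMod.stdAddChar (((i : ℕ) : ZMod m) * l) *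
        ((m : ℂ)⁻¹ * ZMod.stdAddChar (-(((i : ℕ) : ZMod m) * k))) =
        (m : ℂ)⁻¹ * ZMod.stdAddChar (((i : ℕ) : ZMod m) * (l - k)) := fun i => by
      rw [mul_left_comm, ← AddChar.map_add_eq_mul]
      congr 2
      ring
    simp only [this, ← Finset.mul_sum, sum_fin_stdAddChar_mul, sub_eq_zero, eq_comm (a := l)]
    split_ifs with h
    · rw [inv_mul_cancel₀ hm, one_smul, h]
    · simp
  simp [this]

theorem sum_spectralProj (U : Multiplicative (ZMod m) →* A) : ∑ i, spectralProj U i = 1 := by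
  simpa using sum_smul_spectralProj U 0

theorem star_stdAddChar (k : ZMod m) : star (ZMod.stdAddChar k) = ZMod.stdAddChar (-k) := by
  have hm : 0 < ringChar (ZMod m) := by
    rw [ZMod.ringChar_zmod_n]; exact NeZero.pos m
  have := AddChar.starComp_apply hm (φ := (ZMod.stdAddChar : AddChar (ZMod m) ℂ)) k
  rwa [AddChar.inv_apply] at this

theorem star_spectralProj [StarRing A] [StarModule ℂ A] (U : Multiplicative (ZMod m) →* A)
    (hU : ∀ k, star (U k) = U k⁻¹) (i : Fin m) : star (spectralProj U i) = spectralProj U i := by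
  simp only [spectralProj, star_smul, star_sum, star_inv₀, star_natCast, star_stdAddChar, hU]
  congr 1
  refine Fintype.sum_equiv (Equiv.neg (ZMod m)) _ _ fun k => ?_
  simp [← ofAdd_neg]

end Spectral

/-! ### The projections `e_{x,i}` -/

section MinProj

variable {n m : ℕ}

/-- The unitary representation of the `x`-th copy of `ℤ/m` in `C⋆(𝔽(n,m))`. -/
def factorHom (x : Fin n) : Multiplicative (ZMod m) →* GroupCStar (FreeProdCyclic n m) :=
  (GroupCStar.uHom _).comp
    (Monoid.CoprodI.of (M := fun _ : Fin n => Multiplicative (ZMod m)) (i := x))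

theorem star_factorHom (x : Fin n) (k : Multiplicative (ZMod m)) :
    star (factorHom x k) = factorHom x k⁻¹ := by
  change star (GroupCStar.u _) = GroupCStar.u _
  rw [GroupCStar.star_u, ← map_inv]

variable [NeZero m]

theorem minProj_eq_spectralProj (x : Fin n) (i : Fin m) :
    minProj x i = spectralProj (factorHom x) i := rfl

theorem isStarProjection_minProj (x : Fin n) (i : Fin m) : IsStarProjection (minProj x i) := by
  rw [minProj_eq_spectralProj]
  exact ⟨spectralProj_mul_self _ i, star_spectralProj _ (star_factorHom x) i⟩

theorem sum_minProj (x : Fin n) : ∑ i : Fin m, minProj x i = 1 := by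
  simp only [minProj_eq_spectralProj, sum_spectralProj]

/-- The projections `e_{x,i}` generate `C⋆(𝔽(n,m))`. -/
theorem mem_of_forall_minProj_mem (S : Subalgebra ℂ (GroupCStar (FreeProdCyclic n m)))
    (hS : IsClosed (S : Set (GroupCStar (FreeProdCyclic n m))))
    (he : ∀ x i, minProj x i ∈ S) (a : GroupCStar (FreeProdCyclic n m)) : a ∈ S := by
  refine GroupCStar.mem_of_forall_u_mem S hS (fun g => ?_) a
  induction g using Monoid.CoprodI.induction_on with
  | one => rw [GroupCStar.u_one]; exact S.one_mem
  | mul g h hg hh => rw [GroupCStar.u_mul]; exact S.mul_mem hg hh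
  | of x k =>
    have : GroupCStar.u (Monoid.CoprodI.of (M := fun _ : Fin n => Multiplicative (ZMod m)) k) =
        factorHom x (Multiplicative.ofAdd (Multiplicative.toAdd k)) := rfl
    rw [this, ← sum_smul_spectralProj]
    exact S.sum_mem fun i _ => S.smul_mem (he x i) _

end MinProj

/-! ### Projective measurements -/

section Measurement

variable {n m : ℕ} {H : Type} [NormedAddCommGroup H] [InnerProductSpace ℂ H] [CompleteSpace H]

theorem IsStarProjection.inner_apply_apply {P : H →L[ℂ] H} (hP : IsStarProjection P) (v w : H) :
    ⟪P v, P w⟫_ℂ = ⟪v, P w⟫_ℂ := by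
  rw [← ContinuousLinearMap.adjoint_inner_right, ← ContinuousLinearMap.star_eq_adjoint,
    hP.isSelfAdjoint.star_eq, ← mul_apply_eq_comp, hP.isIdempotentElem.eq]

/-- Projections with sum `1` satisfy `∑ ‖E_c w‖² = ‖w‖²`. For `w` in the range of `E_b`, the term `c
= b` already exhausts the sum, so all the others vanish. -/
theorem IsProjectiveMeasurement.mul_eq_zero {E : Fin n → Fin m → (H →L[ℂ] H)}
    (hE : IsProjectiveMeasurement E) (x : Fin n) {a b : Fin m} (hab : a ≠ b) :
    E x a * E x b = 0 := by
  ext v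
  set w := E x b v with hw
  have hbw : E x b w = w := by
    rw [hw, ← mul_apply_eq_comp, (hE.1 x b).isIdempotentElem.eq]
  have h1 : ∑ c, ‖E x c w‖ ^ 2 = ‖w‖ ^ 2 := by
    have : (∑ c, ⟪E x c w, E x c w⟫_ℂ) = ⟪w, w⟫_ℂ := by
      simp only [(hE.1 x _).inner_apply_apply, ← inner_sum, ← sum_apply, hE.2 x,
        one_apply_eq_self]
    simp only [inner_self_eq_norm_sq_to_K] at this
    exact_mod_cast this
  rw [← Finset.add_sum_erase _ _ (Finset.mem_univ b), hbw, add_eq_left,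
    Finset.sum_eq_zero_iff_of_nonneg fun _ _ => by positivity] at h1
  have := h1 a (by simp [hab])
  simpa using this

variable [NeZero m]

/-- The unitaries of `ℤ/m` whose spectral projections are `P`. -/
def unitaryOfProj (P : Fin m → (H →L[ℂ] H)) (hP : ∀ a, IsStarProjection (P a))
    (hP' : ∀ a b, a ≠ b → P a * P b = 0) (hP1 : ∑ a, P a = 1) :
    Multiplicative (ZMod m) →* unitary (H →L[ℂ] H) :=
  let U : Multiplicative (ZMod m) →* (H →L[ℂ] H) :=
    { toFun := fun k =>
        ∑ a : Fin m, ZMod.stdAddChar (((a : ℕ) : ZMod m) * Multiplicative.toAdd k) • P a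
      map_one' := by simpa using hP1
      map_mul' := fun k l => by
        simp only [Finset.sum_mul_sum, smul_mul_smul_comm]
        refine Finset.sum_congr rfl fun a _ => ?_
        rw [Finset.sum_eq_single a]
        · rw [(hP a).isIdempotentElem.eq, ← AddChar.map_add_eq_mul, toAdd_mul, mul_add]
        · intro b _ hb; rw [hP' a b hb.symm, smul_zero]
        · simp }
  have hU : ∀ k, star (U k) = U k⁻¹ := fun k => by
    change star (∑ a : Fin m, _) = ∑ a : Fin m, _
    simp only [star_sum, star_smul, star_stdAddChar, (hP _).isSelfAdjoint.star_eq, toAdd_inv,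
      mul_neg]
  { toFun := fun k => ⟨U k, by
      rw [Unitary.mem_iff, hU, ← map_mul, ← map_mul]; simp⟩
    map_one' := by ext1; exact map_one U
    map_mul' := fun k l => by ext1; exact map_mul U k l }

theorem unitaryOfProj_coe (P : Fin m → (H →L[ℂ] H)) (hP : ∀ a, IsStarProjection (P a))
    (hP' : ∀ a b, a ≠ b → P a * P b = 0) (hP1 : ∑ a, P a = 1) (k : ZMod m) :
    (unitaryOfProj P hP hP' hP1 (Multiplicative.ofAdd k) : H →L[ℂ] H) =
      ∑ a : Fin m, ZMod.stdAddChar (((a : ℕ) : ZMod m) * k) • P a := rfl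

/-- Universal property of `C⋆(𝔽(n,m))` with respect to projective measurements. -/
theorem IsProjectiveMeasurement.exists_rep {E : Fin n → Fin m → (H →L[ℂ] H)}
    (hE : IsProjectiveMeasurement E) :
    ∃ π : GroupCStar (FreeProdCyclic n m) →⋆ₐ[ℂ] (H →L[ℂ] H), ∀ x i, π (minProj x i) = E x i := by
  have hm : (m : ℂ) ≠ 0 := Nat.cast_ne_zero.2 (NeZero.ne m)
  let ρ : UnitaryRep (FreeProdCyclic n m) :=
    { H := H
      toHom := Monoid.CoprodI.lift fun x => unitaryOfProj (E x) (hE.1 x)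
        (fun a b hab => hE.mul_eq_zero x hab) (hE.2 x) }
  refine ⟨GroupCStar.extend ρ, fun x i => ?_⟩
  have h : ∀ k : ZMod m, GroupCStar.extend ρ (GroupCStar.u (Monoid.CoprodI.of
      (M := fun _ : Fin n => Multiplicative (ZMod m)) (i := x) (Multiplicative.ofAdd k))) =
      ∑ a : Fin m, ZMod.stdAddChar (((a : ℕ) : ZMod m) * k) • E x a := fun k => by
    rw [GroupCStar.extend_u]
    simp only [ρ, Monoid.CoprodI.lift_of]
    exact unitaryOfProj_coe ..
  rw [minProj, map_smul, map_sum]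
  simp only [map_smul, h, Finset.smul_sum, smul_smul]
  -- After the exchange of sums, the coefficient of `E x a` is `m⁻¹ ∑_k χ((a - i) k)`, which is `1`
  -- for `a = i` and `0` otherwise.
  rw [Finset.sum_comm, Finset.sum_eq_single i]
  · rw [← Finset.sum_smul, Finset.sum_congr rfl (g := fun _ => (m : ℂ)⁻¹)]
    · simp [ZMod.card, hm]
    · intro k _
      rw [← AddChar.map_add_eq_mul]; simp
  · intro a _ ha
    rw [← Finset.sum_smul]
    have : ∀ k : ZMod m, (m : ℂ)⁻¹ * (ZMod.stdAddChar (-(((i : ℕ) : ZMod m) * k)) *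
        ZMod.stdAddChar (((a : ℕ) : ZMod m) * k)) =
        (m : ℂ)⁻¹ * ZMod.stdAddChar ((((a : ℕ) : ZMod m) - ((i : ℕ) : ZMod m)) * k) := fun k => by
      rw [← AddChar.map_add_eq_mul]
      congr 2
      ring
    simp only [this, ← Finset.mul_sum, sum_stdAddChar_mul]
    rw [if_neg, mul_zero, zero_smul]
    rw [sub_eq_zero]
    exact fun hh => ha (Fin.natCast_zmod_bijective.1 hh)
  · simp

end Measurement

/-! ### Vector functionals and the GNS representation -/

section GNS

open UniformSpace

variable {A : Type*} [CStarAlgebra A] [PartialOrder A] [StarOrderedRing A]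

/-- The positive functional `a ↦ ⟨ψ, π(a) ψ⟩` of a vector in a representation. -/
def vectorFunctional {H : Type*} [NormedAddCommGroup H] [InnerProductSpace ℂ H] [CompleteSpace H]
    (π : A →⋆ₐ[ℂ] (H →L[ℂ] H)) (ψ : H) : A →ₚ[ℂ] ℂ :=
  PositiveLinearMap.mk₀
    { toFun := fun a => ⟪ψ, π a ψ⟫_ℂ
      map_add' := fun a b => by simp
      map_smul' := fun c a => by simp }
    (fun a ha => by
      obtain ⟨b, rfl⟩ := CStarAlgebra.nonneg_iff_eq_star_mul_self.1 ha
      change 0 ≤ ⟪ψ, π (star b * b) ψ⟫_ℂ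
      rw [map_mul, map_star, mul_apply_eq_comp, ContinuousLinearMap.star_eq_adjoint,
        ContinuousLinearMap.adjoint_inner_right, inner_self_eq_norm_sq_to_K]
      exact pow_nonneg (RCLike.ofReal_nonneg.2 (norm_nonneg _)) 2)

theorem vectorFunctional_apply {H : Type*} [NormedAddCommGroup H] [InnerProductSpace ℂ H]
    [CompleteSpace H] (π : A →⋆ₐ[ℂ] (H →L[ℂ] H)) (ψ : H) (a : A) :
    vectorFunctional π ψ a = ⟪ψ, π a ψ⟫_ℂ := rfl

namespace PositiveLinearMap

variable (τ : A →ₚ[ℂ] ℂ)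

/-- The canonical map of a C⋆-algebra into the GNS space. -/
def toGNS (a : A) : τ.GNS := (τ.toPreGNS a : τ.GNS)

variable {τ} in
theorem gns_ext {S T : τ.GNS →L[ℂ] τ.GNS} (h : ∀ a, S (τ.toGNS a) = T (τ.toGNS a)) : S = T := by
  ext v
  induction v using Completion.induction_on with
  | hp => exact isClosed_eq S.continuous T.continuous
  | ih a => exact h (τ.ofPreGNS a)

theorem inner_toGNS (a b : A) : ⟪τ.toGNS a, τ.toGNS b⟫_ℂ = τ (star a * b) :=
  Completion.inner_coe _ _

theorem gnsStarAlgHom_toGNS (a b : A) : τ.gnsStarAlgHom a (τ.toGNS b) = τ.toGNS (a * b) :=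
  gnsNonUnitalStarAlgHom_apply_coe τ

theorem apply_eq_inner (a : A) :
    τ a = ⟪τ.toGNS 1, τ.gnsStarAlgHom a (τ.toGNS 1)⟫_ℂ := by
  rw [gnsStarAlgHom_toGNS, inner_toGNS]; simp

variable {τ}

theorem norm_toGNS_one (h1 : τ 1 = 1) : ‖τ.toGNS 1‖ = 1 := by
  have : ((‖τ.toGNS 1‖ ^ 2 : ℝ) : ℂ) = 1 := by
    have := inner_self_eq_norm_sq_to_K (𝕜 := ℂ) (τ.toGNS 1)
    rw [inner_toGNS, star_one, mul_one, h1] at this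
    rw [this]; simp
  have h2 : ‖τ.toGNS 1‖ ^ 2 = 1 := by exact_mod_cast this
  exact (pow_eq_one_iff_of_nonneg (norm_nonneg _) two_ne_zero).1 h2

/-- Cauchy–Schwarz for the unit vector of `1`, since representations of C⋆-algebras are contractive.
This bounds the game values and puts the states in the dual unit ball. -/
theorem norm_apply_le (h1 : τ 1 = 1) (a : A) : ‖τ a‖ ≤ ‖a‖ := by
  rw [apply_eq_inner]
  calc _ ≤ ‖τ.toGNS 1‖ * ‖τ.gnsStarAlgHom a (τ.toGNS 1)‖ := norm_inner_le_norm _ _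
    _ ≤ 1 * (‖τ.gnsStarAlgHom a‖ * 1) := by
      rw [norm_toGNS_one h1]
      gcongr
      simpa [norm_toGNS_one h1] using (τ.gnsStarAlgHom a).le_opNorm (τ.toGNS 1)
    _ ≤ ‖a‖ := by
      rw [one_mul, mul_one]; exact NonUnitalStarAlgHom.norm_apply_le τ.gnsStarAlgHom a

theorem toGNS_add (a b : A) : τ.toGNS (a + b) = τ.toGNS a + τ.toGNS b := by
  rw [toGNS, map_add, Completion.coe_add]; rfl

theorem toGNS_sub (a b : A) : τ.toGNS (a - b) = τ.toGNS a - τ.toGNS b := by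
  rw [toGNS, map_sub, Completion.coe_sub]; rfl

theorem toGNS_smul (c : ℂ) (a : A) : τ.toGNS (c • a) = c • τ.toGNS a := by
  rw [toGNS, map_smul, Completion.coe_smul]; rfl

/-- Commutators act as zero exactly when all their matrix coefficients on the dense image of the
algebra vanish. This form is linear in `τ`, hence weak-⋆ closed. For the converse, `c = (ab - ba)d`
makes the value the squared norm of the vector to be killed. -/
theorem hasAbelianGNS_iff :
    HasAbelianGNS τ ↔ ∀ a b c d : A, τ (star c * ((a * b - b * a) * d)) = 0 := by
  constructor
  · intro h a b c d
    rw [← inner_toGNS, ← gnsStarAlgHom_toGNS, map_sub, map_mul, map_mul, (h a b).eq, sub_self]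
    simp
  · intro h a b
    refine gns_ext fun d => ?_
    rw [← map_mul, ← map_mul, gnsStarAlgHom_toGNS, gnsStarAlgHom_toGNS, ← sub_eq_zero,
      ← inner_self_eq_zero (𝕜 := ℂ)]
    rw [← toGNS_sub, ← sub_mul, inner_toGNS]
    exact h _ _ _ _

end PositiveLinearMap

namespace IsTracialState

variable {τ : A →ₚ[ℂ] ℂ}

/-- Right multiplication by `b` on the GNS space of a tracial state. -/
def rightMul (hτ : IsTracialState τ) (b : A) : τ.GNS →L[ℂ] τ.GNS :=
  (LinearMap.mkContinuous (τ.toPreGNS.toLinearMap ∘ₗ LinearMap.mulRight ℂ b ∘ₗ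
    τ.ofPreGNS.toLinearMap : τ.PreGNS →ₗ[ℂ] τ.PreGNS) ‖b‖ fun v => by
    set a : A := τ.ofPreGNS v
    -- Boundedness rests on the trace property: `τ((ab)⋆(ab)) = τ(a bb⋆ a⋆) ≤ ‖b‖² τ(aa⋆)`.
    have ha : (‖v‖ ^ 2 : ℂ) = τ (a * star a) := by
      rw [τ.preGNS_norm_sq, hτ.map_mul_comm]
    have hab : (‖(τ.toPreGNS (a * b) : τ.PreGNS)‖ ^ 2 : ℂ) = τ (a * (b * star b) * star a) := by
      rw [τ.preGNS_norm_sq, hτ.map_mul_comm]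
      simp [mul_assoc]
    rw [← sq_le_sq₀ (by positivity) (by positivity), mul_pow, ← Complex.real_le_real]
    change ((‖(τ.toPreGNS (a * b) : τ.PreGNS)‖ ^ 2 : ℝ) : ℂ) ≤ _
    push_cast
    rw [hab, ha]
    calc τ (a * (b * star b) * star a) ≤ τ (‖b * star b‖ • (a * star a)) :=
          OrderHomClass.mono τ (CStarAlgebra.star_right_conjugate_le_norm_smul)
      _ = _ := by
        rw [CStarRing.norm_self_mul_star, ← Complex.coe_smul, map_smul, smul_eq_mul]
        push_cast
        ring).completion

theorem rightMul_toGNS (hτ : IsTracialState τ) (a b : A) :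
    hτ.rightMul b (τ.toGNS a) = τ.toGNS (a * b) :=
  ContinuousLinearMap.completion_apply_coe _ _

/-- Right multiplication reverses products, which is harmless for single projections. -/
theorem rightMul_mul (hτ : IsTracialState τ) (a b : A) :
    hτ.rightMul a * hτ.rightMul b = hτ.rightMul (b * a) :=
  PositiveLinearMap.gns_ext fun c => by
    simp only [mul_apply_eq_comp, rightMul_toGNS, mul_assoc]

theorem rightMul_one (hτ : IsTracialState τ) : hτ.rightMul 1 = 1 :=
  PositiveLinearMap.gns_ext fun c => by
    simp only [one_apply_eq_self, rightMul_toGNS, mul_one]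

theorem rightMul_add (hτ : IsTracialState τ) (a b : A) :
    hτ.rightMul (a + b) = hτ.rightMul a + hτ.rightMul b :=
  PositiveLinearMap.gns_ext fun c => by
    simp only [add_apply, rightMul_toGNS, mul_add, PositiveLinearMap.toGNS_add]

theorem rightMul_sum (hτ : IsTracialState τ) {ι : Type*} (s : Finset ι) (f : ι → A) :
    hτ.rightMul (∑ i ∈ s, f i) = ∑ i ∈ s, hτ.rightMul (f i) :=
  map_sum (AddMonoidHom.mk' hτ.rightMul hτ.rightMul_add) f s

theorem star_rightMul (hτ : IsTracialState τ) (a : A) :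
    star (hτ.rightMul a) = hτ.rightMul (star a) := by
  symm
  rw [ContinuousLinearMap.star_eq_adjoint, ContinuousLinearMap.eq_adjoint_iff]
  intro v w
  induction v, w using Completion.induction_on₂ with
  | hp => apply isClosed_eq <;> fun_prop
  | ih v w =>
    change ⟪hτ.rightMul (star a) (τ.toGNS (τ.ofPreGNS v)), τ.toGNS (τ.ofPreGNS w)⟫_ℂ =
      ⟪τ.toGNS (τ.ofPreGNS v), hτ.rightMul a (τ.toGNS (τ.ofPreGNS w))⟫_ℂ
    rw [rightMul_toGNS, rightMul_toGNS, PositiveLinearMap.inner_toGNS,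
      PositiveLinearMap.inner_toGNS, star_mul, star_star, mul_assoc, hτ.map_mul_comm, mul_assoc]

theorem commute_rightMul (hτ : IsTracialState τ) (a b : A) :
    Commute (τ.gnsStarAlgHom a) (hτ.rightMul b) :=
  PositiveLinearMap.gns_ext fun c => by
    simp only [mul_apply_eq_comp, rightMul_toGNS, PositiveLinearMap.gnsStarAlgHom_toGNS, mul_assoc]

theorem isStarProjection_rightMul (hτ : IsTracialState τ) {e : A} (he : IsStarProjection e) :
    IsStarProjection (hτ.rightMul e) :=
  ⟨by rw [IsIdempotentElem, rightMul_mul, he.isIdempotentElem.eq],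
    by rw [IsSelfAdjoint, star_rightMul, he.isSelfAdjoint.star_eq]⟩

/-- The trace property gives `τ(ef) = τ(efe) = τ((fe)⋆(fe))`. So the candidate probabilities are
real, and taking real parts in `traceCorrelation` loses nothing. -/
theorem nonneg_of_isStarProjection (hτ : IsTracialState τ) {e f : A} (he : IsStarProjection e)
    (hf : IsStarProjection f) : 0 ≤ τ (e * f) := by
  have h : τ (e * f) = τ (star (f * e) * (f * e)) := by
    rw [star_mul, he.isSelfAdjoint.star_eq, hf.isSelfAdjoint.star_eq, mul_assoc, ← mul_assoc f,
      hf.isIdempotentElem.eq, hτ.map_mul_comm e (f * e), mul_assoc, he.isIdempotentElem.eq,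
      hτ.map_mul_comm]
  rw [h]
  exact τ.map_nonneg (star_mul_self_nonneg _)

end IsTracialState

end GNS

/-! ### Correlations of tracial states -/

section TraceCorrelation

variable {n m : ℕ} [NeZero m]

theorem payoff_eq_apply_gameElement (G : Game n m) (Γ : InputDistribution n)
    (τ : GroupCStar (FreeProdCyclic n m) →ₚ[ℂ] ℂ) (p : Correlation n m)
    (hp : ∀ x y i j, (p x y i j : ℂ) = τ (minProj x i * minProj y j)) :
    (payoff G Γ p : ℂ) = τ (gameElement G Γ) := by
  simp only [payoff, gameElement, map_sum, map_smul, Complex.ofReal_sum, Complex.ofReal_mul, hp,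
    smul_eq_mul]

/-- The correlation `p(i,j|x,y) = τ(e_{x,i} e_{y,j})` of a functional `τ`. -/
def traceCorrelation (τ : GroupCStar (FreeProdCyclic n m) →ₚ[ℂ] ℂ) : Correlation n m :=
  fun x y i j => (τ (minProj x i * minProj y j)).re

variable {τ : GroupCStar (FreeProdCyclic n m) →ₚ[ℂ] ℂ}

theorem IsTracialState.traceCorrelation_coe (hτ : IsTracialState τ) (x y : Fin n) (i j : Fin m) :
    (traceCorrelation τ x y i j : ℂ) = τ (minProj x i * minProj y j) :=
  (Complex.eq_re_of_ofReal_le (r := 0) (by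
    simpa using hτ.nonneg_of_isStarProjection (isStarProjection_minProj x i)
      (isStarProjection_minProj y j))).symm

/-- The images of the `e_{x,i}` under a representation are a projective measurement. -/
theorem isProjectiveMeasurement_rep {H : Type} [NormedAddCommGroup H] [InnerProductSpace ℂ H]
    [CompleteSpace H] (π : GroupCStar (FreeProdCyclic n m) →⋆ₐ[ℂ] (H →L[ℂ] H)) :
    IsProjectiveMeasurement (n := n) (m := m) fun x i => π (minProj x i) :=
  ⟨fun x i => (isStarProjection_minProj x i).map π, fun x => by
    rw [← map_sum, sum_minProj, map_one]⟩

theorem IsTracialState.isProjectiveMeasurement_rightMul (hτ : IsTracialState τ) :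
    IsProjectiveMeasurement (n := n) (m := m) fun x i => hτ.rightMul (minProj x i) :=
  ⟨fun x i => hτ.isStarProjection_rightMul (isStarProjection_minProj x i), fun x => by
    rw [← hτ.rightMul_sum, sum_minProj, hτ.rightMul_one]⟩

theorem IsTracialState.traceCorrelation_mem_synchronous (hτ : IsTracialState τ) :
    traceCorrelation τ ∈ synchronous n m := fun x a b hab => by
  have h := (isProjectiveMeasurement_rep τ.gnsStarAlgHom).mul_eq_zero x hab
  have : (traceCorrelation τ x x a b : ℂ) = 0 := by
    rw [hτ.traceCorrelation_coe, τ.apply_eq_inner, map_mul, h]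
    simp
  exact_mod_cast this

/-- The players use left and right multiplication on the GNS space, and the shared state is the
vector of `1`. -/
theorem IsTracialState.traceCorrelation_mem_Cqc (hτ : IsTracialState τ) :
    traceCorrelation τ ∈ Cqc n m :=
  ⟨τ.GNS, inferInstance, inferInstance, inferInstance, fun x i => τ.gnsStarAlgHom (minProj x i),
    fun y j => hτ.rightMul (minProj y j), τ.toGNS 1, isProjectiveMeasurement_rep _,
    hτ.isProjectiveMeasurement_rightMul, fun _ _ _ _ => hτ.commute_rightMul _ _,
    PositiveLinearMap.norm_toGNS_one hτ.map_one, fun x y a b => by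
      rw [hτ.traceCorrelation_coe, mul_apply_eq_comp, hτ.rightMul_toGNS,
        τ.gnsStarAlgHom_toGNS, τ.inner_toGNS]
      simp⟩

theorem IsTracialState.traceCorrelation_mem_Cloc (hτ : IsTracialState τ) (ha : HasAbelianGNS τ) :
    traceCorrelation τ ∈ Cloc n m :=
  ⟨τ.GNS, inferInstance, inferInstance, inferInstance, fun x i => τ.gnsStarAlgHom (minProj x i),
    fun x i => τ.gnsStarAlgHom (minProj x i), τ.toGNS 1, isProjectiveMeasurement_rep _,
    isProjectiveMeasurement_rep _, fun _ _ _ _ => ha _ _, fun _ _ _ _ => ha _ _,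
    fun _ _ _ _ => ha _ _, PositiveLinearMap.norm_toGNS_one hτ.map_one, fun x y a b => by
      rw [hτ.traceCorrelation_coe, ← map_mul, ← τ.apply_eq_inner]⟩

end TraceCorrelation

/-! ### Tracial states of synchronous strategies -/

section Strategy

variable {n m : ℕ} {H : Type} [NormedAddCommGroup H] [InnerProductSpace ℂ H] [CompleteSpace H]

/-- In a synchronous strategy the operators of the two players agree on the state. -/
theorem IsProjectiveMeasurement.apply_eq_apply_of_synchronous {E F : Fin n → Fin m → (H →L[ℂ] H)}
    {ψ : H} (hE : IsProjectiveMeasurement E) (hF : IsProjectiveMeasurement F)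
    (hEF : ∀ x y a b, Commute (E x a) (F y b))
    (hs : ∀ x a b, a ≠ b → ⟪ψ, (E x a * F x b) ψ⟫_ℂ = 0) (x : Fin n) (a : Fin m) :
    E x a ψ = F x a ψ := by
  -- Commuting projections multiply to a projection `P`, and `⟪ψ, P ψ⟫ = 0` means `P ψ = 0`.
  have h0 : ∀ a b, a ≠ b → E x a (F x b ψ) = 0 := fun a b hab => by
    have hp : IsStarProjection (E x a * F x b) := (hE.1 x a).mul (hF.1 x b) (hEF x x a b)
    have h := hs x a b hab
    rw [← hp.inner_apply_apply] at h
    exact inner_self_eq_zero.1 h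
  -- Insert `∑ E = 1` here and `∑ F = 1` in `h2`; in each sum only the diagonal term survives.
  have h1 : F x a ψ = E x a (F x a ψ) := by
    have : F x a ψ = ∑ c, E x c (F x a ψ) := by
      rw [← sum_apply, hE.2, one_apply_eq_self]
    rw [Finset.sum_eq_single a (fun c _ hc => h0 c a hc) (by simp)] at this
    exact this
  have h2 : E x a ψ = E x a (F x a ψ) := by
    have : E x a ψ = ∑ c, E x a (F x c ψ) := by
      rw [← map_sum, ← sum_apply, hF.2, one_apply_eq_self]
    rw [Finset.sum_eq_single a (fun c _ hc => h0 a c hc.symm) (by simp)] at this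
    exact this
  rw [h2, ← h1]

variable [NeZero m] {A : Type*} [CStarAlgebra A]

theorem StarAlgHom.continuous_of_cstar (π : A →⋆ₐ[ℂ] (H →L[ℂ] H)) : Continuous π :=
  AddMonoidHomClass.continuous_of_bound π 1 fun a => by
    rw [one_mul]; exact NonUnitalStarAlgHom.norm_apply_le π a

/-- An operator that commutes with all `π(e_{x,i})` commutes with the image of `π`. -/
theorem commute_rep_of_forall_minProj (π : GroupCStar (FreeProdCyclic n m) →⋆ₐ[ℂ] (H →L[ℂ] H))
    (T : H →L[ℂ] H) (hT : ∀ x i, Commute (π (minProj x i)) T)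
    (a : GroupCStar (FreeProdCyclic n m)) : Commute (π a) T := by
  have hπ := π.continuous_of_cstar
  let S : Subalgebra ℂ (GroupCStar (FreeProdCyclic n m)) :=
    (Subalgebra.centralizer ℂ {T}).comap π.toAlgHom
  have hS : ∀ a, a ∈ S ↔ T * π a = π a * T := fun a => by
    simp only [S, Subalgebra.mem_comap, Subalgebra.mem_centralizer_iff, Set.mem_singleton_iff,
      forall_eq]
    rfl
  have hc : IsClosed (S : Set (GroupCStar (FreeProdCyclic n m))) := by
    have : (S : Set (GroupCStar (FreeProdCyclic n m))) = {a | T * π a = π a * T} :=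
      Set.ext hS
    rw [this]
    exact isClosed_eq (continuous_const.mul hπ) (hπ.mul continuous_const)
  exact ((hS a).1 (mem_of_forall_minProj_mem S hc (fun x i => (hS _).2 (hT x i).eq.symm) a)).symm

theorem commute_rep_rep_of_forall_minProj
    (π : GroupCStar (FreeProdCyclic n m) →⋆ₐ[ℂ] (H →L[ℂ] H))
    (hπ : ∀ x y i j, Commute (π (minProj x i)) (π (minProj y j)))
    (a b : GroupCStar (FreeProdCyclic n m)) : Commute (π a) (π b) :=
  commute_rep_of_forall_minProj π _ (fun x i =>
    (commute_rep_of_forall_minProj π _ (fun y j => hπ y x j i) b).symm) a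

/-- A vector state is tracial if the `π(e_{x,i})` act on the vector like operators that commute
with the representation. -/
theorem isTracialState_vectorFunctional (π : GroupCStar (FreeProdCyclic n m) →⋆ₐ[ℂ] (H →L[ℂ] H))
    {F : Fin n → Fin m → (H →L[ℂ] H)} {ψ : H} (hψ : ‖ψ‖ = 1) (hF : ∀ x i, IsSelfAdjoint (F x i))
    (hc : ∀ x y i j, Commute (π (minProj x i)) (F y j))
    (h : ∀ x i, π (minProj x i) ψ = F x i ψ) : IsTracialState (vectorFunctional π ψ) := by
  have hπ := π.continuous_of_cstar
  have h1 : vectorFunctional π ψ 1 = 1 := by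
    rw [vectorFunctional_apply, map_one, one_apply_eq_self, inner_self_eq_norm_sq_to_K, hψ]
    simp
  refine ⟨h1, fun a b => ?_⟩
  -- The elements `b` that can be cycled past every `a` form a closed subalgebra, so it suffices to
  -- treat the generators `e_{x,i}`.
  let S : Subalgebra ℂ (GroupCStar (FreeProdCyclic n m)) :=
    { carrier := {b | ∀ a, vectorFunctional π ψ (a * b) = vectorFunctional π ψ (b * a)}
      mul_mem' := fun {b c} hb hc' a => by
        rw [← mul_assoc, hc', ← mul_assoc, hb, mul_assoc]
      add_mem' := fun {b c} hb hc' a => by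
        rw [mul_add, map_add, hb, hc', add_mul, map_add]
      algebraMap_mem' := fun r a => by
        rw [Algebra.commutes] }
  have hS : IsClosed (S : Set (GroupCStar (FreeProdCyclic n m))) := by
    have : (S : Set (GroupCStar (FreeProdCyclic n m))) =
        ⋂ a, {b | ⟪ψ, π (a * b) ψ⟫_ℂ = ⟪ψ, π (b * a) ψ⟫_ℂ} := by
      ext b; simp only [Set.mem_iInter]; rfl
    rw [this]
    refine isClosed_iInter fun a => isClosed_eq ?_ ?_
    · exact continuous_const.inner
        ((hπ.comp (continuous_const.mul continuous_id)).clm_apply continuous_const)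
    · exact continuous_const.inner
        ((hπ.comp (continuous_id.mul continuous_const)).clm_apply continuous_const)
  refine mem_of_forall_minProj_mem S hS (fun x i w => ?_) b a
  have hw := (commute_rep_of_forall_minProj π (F x i) (fun y j => hc y x j i) w).eq
  have he : IsSelfAdjoint (π (minProj x i)) :=
    ((isStarProjection_minProj x i).map π).isSelfAdjoint
  -- With `e = π(e_{x,i})`, `f = F x i` and `w` short for `π w`: `⟪ψ, w e ψ⟫ = ⟪ψ, w f ψ⟫ = ⟪f ψ, w
  -- ψ⟫ = ⟪e ψ, w ψ⟫ = ⟪ψ, e w ψ⟫`.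
  rw [vectorFunctional_apply, vectorFunctional_apply, map_mul, map_mul, mul_apply_eq_comp,
    mul_apply_eq_comp, h, ← mul_apply_eq_comp, hw, mul_apply_eq_comp,
    ← (hF x i).star_eq, ContinuousLinearMap.star_eq_adjoint, ContinuousLinearMap.adjoint_inner_right,
    ← h, ← ContinuousLinearMap.adjoint_inner_right, ← ContinuousLinearMap.star_eq_adjoint,
    he.star_eq]

/-- The state of a synchronous commuting strategy, with the first player's operators as
representation. -/
theorem exists_tracialState_of_strategy {E F : Fin n → Fin m → (H →L[ℂ] H)} {ψ : H}
    (hE : IsProjectiveMeasurement E) (hF : IsProjectiveMeasurement F)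
    (hEF : ∀ x y a b, Commute (E x a) (F y b)) (hψ : ‖ψ‖ = 1) {p : Correlation n m}
    (hp : ∀ x y a b, (p x y a b : ℂ) = ⟪ψ, (E x a * F y b) ψ⟫_ℂ) (hs : p ∈ synchronous n m) :
    ∃ π : GroupCStar (FreeProdCyclic n m) →⋆ₐ[ℂ] (H →L[ℂ] H), (∀ x i, π (minProj x i) = E x i) ∧
      IsTracialState (vectorFunctional π ψ) ∧
      ∀ x y i j, (p x y i j : ℂ) = vectorFunctional π ψ (minProj x i * minProj y j) := by
  obtain ⟨π, hπ⟩ := hE.exists_rep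
  have h := hE.apply_eq_apply_of_synchronous hF hEF (ψ := ψ) fun x a b hab => by
    rw [← hp, hs x a b hab, Complex.ofReal_zero]
  refine ⟨π, hπ, isTracialState_vectorFunctional π hψ (fun x i => (hF.1 x i).isSelfAdjoint)
    (fun x y i j => by rw [hπ]; exact hEF x y i j) (fun x i => by rw [hπ]; exact h x i),
    fun x y i j => ?_⟩
  rw [hp, vectorFunctional_apply, map_mul, hπ, hπ, mul_apply_eq_comp, mul_apply_eq_comp, h]

end Strategy

/-! ### GNS representations of vector functionals -/

section VectorGNS

variable {A : Type*} [CStarAlgebra A] [PartialOrder A] [StarOrderedRing A]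
variable {H : Type*} [NormedAddCommGroup H] [InnerProductSpace ℂ H] [CompleteSpace H]

theorem hasAbelianGNS_vectorFunctional (π : A →⋆ₐ[ℂ] (H →L[ℂ] H)) (ψ : H)
    (hπ : ∀ a b, Commute (π a) (π b)) : HasAbelianGNS (vectorFunctional π ψ) := by
  rw [PositiveLinearMap.hasAbelianGNS_iff]
  intro a b c d
  rw [vectorFunctional_apply, map_mul, map_mul, map_sub, map_mul, map_mul, (hπ a b).eq, sub_self]
  simp

/-- The GNS norm of `a` is `‖π(a) ψ‖`, so the map into the GNS space factors through the finite
dimensional space of vectors `π(a) ψ`. Its range is then closed as well as dense. -/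
theorem hasFiniteDimensionalGNS_vectorFunctional [FiniteDimensional ℂ H]
    (π : A →⋆ₐ[ℂ] (H →L[ℂ] H)) (ψ : H) : HasFiniteDimensionalGNS (vectorFunctional π ψ) := by
  set τ := vectorFunctional π ψ
  let V : A →ₗ[ℂ] H :=
    { toFun := fun a => π a ψ
      map_add' := fun a b => by simp
      map_smul' := fun c a => by simp }
  let L : A →ₗ[ℂ] τ.GNS :=
    { toFun := τ.toGNS
      map_add' := PositiveLinearMap.toGNS_add
      map_smul' := PositiveLinearMap.toGNS_smul }
  have hVL : V.ker ≤ L.ker := fun a ha => by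
    have ha' : π a ψ = 0 := ha
    change τ.toGNS a = 0
    rw [← inner_self_eq_zero (𝕜 := ℂ), τ.inner_toGNS]
    change ⟪ψ, π (star a * a) ψ⟫_ℂ = 0
    rw [map_mul, mul_apply_eq_comp, ha']
    simp
  have : FiniteDimensional ℂ (A ⧸ V.ker) := V.quotKerEquivRange.symm.finiteDimensional
  have hr : FiniteDimensional ℂ L.range := by
    rw [← Submodule.range_liftQ _ L hVL]
    infer_instance
  have hcl : IsClosed (L.range : Set τ.GNS) := Submodule.closed_of_finiteDimensional _
  have htop : L.range = ⊤ := by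
    rw [eq_top_iff]
    intro v hv
    clear hv
    induction v using UniformSpace.Completion.induction_on with
    | hp => exact hcl
    | ih a => exact ⟨τ.ofPreGNS a, rfl⟩
  rw [htop] at hr
  exact Submodule.topEquiv.finiteDimensional

end VectorGNS

/-! ### From synchronous correlations to tracial states -/

section CorrelationState

variable {n m : ℕ} [NeZero m]

theorem exists_tracialState_of_mem_Cqc {p : Correlation n m} (hp : p ∈ Cqc n m)
    (hs : p ∈ synchronous n m) : ∃ τ : GroupCStar (FreeProdCyclic n m) →ₚ[ℂ] ℂ,
      IsTracialState τ ∧ ∀ x y i j, (p x y i j : ℂ) = τ (minProj x i * minProj y j) := by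
  obtain ⟨H, _, _, _, E, F, ψ, hE, hF, hEF, hψ, hp⟩ := hp
  obtain ⟨π, -, hτ, h⟩ := exists_tracialState_of_strategy hE hF hEF hψ hp hs
  exact ⟨_, hτ, h⟩

theorem exists_tracialState_of_mem_Cloc {p : Correlation n m} (hp : p ∈ Cloc n m)
    (hs : p ∈ synchronous n m) : ∃ τ : GroupCStar (FreeProdCyclic n m) →ₚ[ℂ] ℂ,
      IsTracialState τ ∧ HasAbelianGNS τ ∧
      ∀ x y i j, (p x y i j : ℂ) = τ (minProj x i * minProj y j) := by
  obtain ⟨H, _, _, _, E, F, ψ, hE, hF, hEF, hEE, -, hψ, hp⟩ := hp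
  obtain ⟨π, hπ, hτ, h⟩ := exists_tracialState_of_strategy hE hF hEF hψ hp hs
  refine ⟨_, hτ, hasAbelianGNS_vectorFunctional π ψ
    (commute_rep_rep_of_forall_minProj π fun x y i j => ?_), h⟩
  rw [hπ, hπ]
  exact hEE x y i j

/-- The operators `E ⊗ 1` and `1 ⊗ F` form a commuting strategy on the finite dimensional space `HA
⊗ HB`. -/
theorem exists_tracialState_of_mem_Cq {p : Correlation n m} (hp : p ∈ Cq n m)
    (hs : p ∈ synchronous n m) : ∃ τ : GroupCStar (FreeProdCyclic n m) →ₚ[ℂ] ℂ,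
      IsTracialState τ ∧ HasFiniteDimensionalGNS τ ∧
      ∀ x y i j, (p x y i j : ℂ) = τ (minProj x i * minProj y j) := by
  obtain ⟨HA, _, _, _, _, HB, _, _, _, _, E, F, ψ, hE, hF, hψ, hp⟩ := hp
  have : CompleteSpace (HA ⊗[ℂ] HB) := FiniteDimensional.complete ℂ _
  have hE' : IsProjectiveMeasurement fun x a => (E x a).rTensor HB := by
    refine ⟨fun x a => ⟨?_, ?_⟩, fun x => ?_⟩
    · rw [IsIdempotentElem, ← ContinuousLinearMap.rTensor_mul, (hE.1 x a).isIdempotentElem.eq]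
    · rw [IsSelfAdjoint, ContinuousLinearMap.star_eq_adjoint, ContinuousLinearMap.adjoint_rTensor,
        ← ContinuousLinearMap.star_eq_adjoint, (hE.1 x a).isSelfAdjoint.star_eq]
    · rw [← ContinuousLinearMap.rTensor_one, ← hE.2 x]
      exact (map_sum (AddMonoidHom.mk' (fun f : HA →L[ℂ] HA => f.rTensor HB)
        (ContinuousLinearMap.rTensor_add HB)) _ _).symm
  have hF' : IsProjectiveMeasurement fun x a => (F x a).lTensor HA := by
    refine ⟨fun x a => ⟨?_, ?_⟩, fun x => ?_⟩
    · rw [IsIdempotentElem, ← ContinuousLinearMap.lTensor_mul, (hF.1 x a).isIdempotentElem.eq]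
    · rw [IsSelfAdjoint, ContinuousLinearMap.star_eq_adjoint, ContinuousLinearMap.adjoint_lTensor,
        ← ContinuousLinearMap.star_eq_adjoint, (hF.1 x a).isSelfAdjoint.star_eq]
    · rw [← ContinuousLinearMap.lTensor_one, ← hF.2 x]
      exact (map_sum (AddMonoidHom.mk' (fun f : HB →L[ℂ] HB => f.lTensor HA)
        (ContinuousLinearMap.lTensor_add HA)) _ _).symm
  have hEF : ∀ x y a b, Commute ((E x a).rTensor HB) ((F y b).lTensor HA) := fun x y a b =>
    (ContinuousLinearMap.rTensor_comp_lTensor _ _).trans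
      (ContinuousLinearMap.lTensor_comp_rTensor _ _).symm
  obtain ⟨π, -, hτ, h⟩ := exists_tracialState_of_strategy hE' hF' hEF hψ
    (p := p) (fun x y a b => by
      rw [hp, ← TensorProduct.mapL_apply]
      rfl) hs
  exact ⟨_, hτ, hasFiniteDimensionalGNS_vectorFunctional π ψ, h⟩

end CorrelationState

/-! ### Tracial functionals on matrix ⋆-algebras -/

section MatrixDensity

variable {ι : Type*} [Fintype ι]

theorem Matrix.trace_star_mul_self_nonneg (a : Matrix ι ι ℂ) : 0 ≤ (star a * a).trace :=
  (Matrix.posSemidef_conjTranspose_mul_self a).trace_nonneg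

theorem Matrix.eq_zero_of_trace_star_mul_self {a : Matrix ι ι ℂ} (h : (star a * a).trace = 0) :
    a = 0 :=
  Matrix.trace_conjTranspose_mul_self_eq_zero_iff.1 h

variable [DecidableEq ι]

/-- Every linear functional on a ⋆-algebra `S` of matrices is of the form `a ↦ tr(a h)`, `h ∈ S`. -/
theorem StarSubalgebra.exists_trace_density (S : StarSubalgebra ℂ (Matrix ι ι ℂ))
    (φ : Matrix ι ι ℂ →ₗ[ℂ] ℂ) : ∃ h ∈ S, ∀ a ∈ S, φ a = (a * h).trace := by
  let V : Submodule ℂ (Matrix ι ι ℂ) := S.toSubalgebra.toSubmodule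
  let B : V →ₗ[ℂ] Module.Dual ℂ V :=
    (((LinearMap.mul ℂ (Matrix ι ι ℂ)).flip.compr₂ (Matrix.traceLinearMap ι ℂ ℂ)).domRestrict₁₂ V V)
  have hB : ∀ h a : V, B h a = ((a : Matrix ι ι ℂ) * (h : Matrix ι ι ℂ)).trace := fun h a => rfl
  -- The trace pairing on `S` is nondegenerate because `h⋆ ∈ S` may be paired with `h`; equality of
  -- dimensions then gives surjectivity.
  have hinj : Function.Injective B := by
    rw [injective_iff_map_eq_zero]
    intro h hh
    have h1 := hB h ⟨star (h : Matrix ι ι ℂ), star_mem (s := S) h.2⟩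
    rw [hh, LinearMap.zero_apply] at h1
    exact Subtype.ext (Matrix.eq_zero_of_trace_star_mul_self h1.symm)
  have hsurj : Function.Surjective B :=
    (LinearMap.injective_iff_surjective_of_finrank_eq_finrank
      (Subspace.dual_finrank_eq (K := ℂ) (V := V)).symm).1 hinj
  obtain ⟨h, hh⟩ := hsurj (φ.domRestrict V)
  exact ⟨h, h.2, fun a ha => by rw [← hB h ⟨a, ha⟩, hh]; rfl⟩

/-- A tracial positive functional on a ⋆-algebra `S` of matrices is of the form `a ↦ tr(a s²)`
for a selfadjoint matrix `s` that commutes with `S`. -/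
theorem StarSubalgebra.exists_sqrt_trace_density (S : StarSubalgebra ℂ (Matrix ι ι ℂ))
    (φ : Matrix ι ι ℂ →ₗ[ℂ] ℂ) (hstar : ∀ a, φ (star a) = star (φ a))
    (hpos : ∀ a ∈ S, 0 ≤ φ (star a * a)) (htr : ∀ a ∈ S, ∀ b ∈ S, φ (a * b) = φ (b * a)) :
    ∃ s : Matrix ι ι ℂ, IsSelfAdjoint s ∧ (∀ a ∈ S, Commute s a) ∧
      ∀ a ∈ S, φ a = (a * (s * s)).trace := by
  obtain ⟨h, hS, hφ⟩ := S.exists_trace_density φ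
  -- A density inside `S` is unique. Hence the symmetries of `φ` pass to `h`: hermitian gives
  -- selfadjoint, tracial gives central in `S`.
  have huniq : ∀ k ∈ S, (∀ a ∈ S, (a * k).trace = 0) → k = 0 := fun k hk h0 =>
    Matrix.eq_zero_of_trace_star_mul_self (h0 _ (star_mem (s := S) hk))
  have hsa : IsSelfAdjoint h := by
    rw [IsSelfAdjoint, ← sub_eq_zero]
    refine huniq _ (S.sub_mem (star_mem (s := S) hS) hS) fun a ha => ?_
    have h1 : (a * star h).trace = φ a := by
      have := congrArg star (hφ _ (star_mem (s := S) ha))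
      rw [hstar, star_star] at this
      rw [this, Matrix.trace_mul_comm (star a), ← Matrix.trace_conjTranspose]
      simp [Matrix.star_eq_conjTranspose]
    rw [mul_sub, Matrix.trace_sub, h1, hφ a ha, sub_self]
  have hcomm : ∀ b ∈ S, Commute h b := fun b hb => by
    rw [Commute, SemiconjBy, ← sub_eq_zero]
    refine huniq _ (S.sub_mem (S.mul_mem hS hb) (S.mul_mem hb hS)) fun a ha => ?_
    rw [mul_sub, Matrix.trace_sub, ← mul_assoc, Matrix.trace_mul_comm, ← mul_assoc, ← mul_assoc,
      ← hφ _ (S.mul_mem hb ha), ← hφ _ (S.mul_mem ha hb), htr b hb a ha, sub_self]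
  have : IsClosed (S : Set (Matrix ι ι ℂ)) :=
    Submodule.closed_of_finiteDimensional S.toSubalgebra.toSubmodule
  -- `s` and `r` are the square roots of the positive and negative parts of `h`. Positivity of `φ`
  -- is known only on `S`, so `r` has to lie in `S`; this is where closedness of `S` enters.
  set s := cfc (fun t : ℝ => √(max t 0)) h with hs
  set r := cfc (fun t : ℝ => √(max (-t) 0)) h with hr
  have hrS : r ∈ S := cfc_mem (𝕜' := ℂ) _ hS
  have hrsa : IsSelfAdjoint r := cfc_predicate _ _
  have hdec : s * s - r * r = h := by
    rw [hs, hr, ← cfc_mul .., ← cfc_mul .., ← cfc_sub ..]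
    conv_rhs => rw [← cfc_id ℝ h]
    refine cfc_congr fun t _ => ?_
    simp only [Real.mul_self_sqrt (le_max_right _ _), id]
    rcases le_total t 0 with ht | ht
    · rw [max_eq_right ht, max_eq_left (by linarith)]; ring
    · rw [max_eq_left ht, max_eq_right (by linarith)]; ring
  have hrs : r * s = 0 := by
    rw [hs, hr, ← cfc_mul .., ← cfc_zero ℝ h]
    refine cfc_congr fun t _ => ?_
    rcases le_total t 0 with ht | ht
    · simp [max_eq_right ht]
    · simp [max_eq_right (neg_nonpos.2 ht)]
  -- Testing positivity on `r` gives `0 ≤ φ(r⋆r) = tr(r²(s² - r²)) = -tr(r⁴)`.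
  have hrr : r * r = 0 := by
    refine Matrix.eq_zero_of_trace_star_mul_self
      (le_antisymm ?_ (Matrix.trace_star_mul_self_nonneg _))
    have h1 := hpos r hrS
    rw [hφ _ (S.mul_mem (star_mem (s := S) hrS) hrS), ← hdec, mul_sub, hrsa.star_eq,
      show r * r * (s * s) = r * (r * s) * s by simp only [mul_assoc], hrs, mul_zero, zero_mul,
      zero_sub, Matrix.trace_neg, neg_nonneg] at h1
    rwa [star_mul, hrsa.star_eq]
  rw [hrr, sub_zero] at hdec
  exact ⟨s, cfc_predicate _ _, fun a ha => (hcomm a ha).cfc_real _,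
    fun a ha => by rw [hdec, hφ a ha]⟩

/-- The vector of `ℂ^ι ⊗ ℂ^ι` whose coordinates are the entries of a matrix. -/
def Matrix.toTensor (s : Matrix ι ι ℂ) : EuclideanSpace ℂ ι ⊗[ℂ] EuclideanSpace ℂ ι :=
  ∑ i, ∑ j, EuclideanSpace.single i (s i j) ⊗ₜ[ℂ] EuclideanSpace.single j 1

theorem Matrix.inner_single_toEuclideanCLM (a : Matrix ι ι ℂ) (i j : ι) (c d : ℂ) :
    ⟪(EuclideanSpace.single i c : EuclideanSpace ℂ ι),
      Matrix.toEuclideanCLM (𝕜 := ℂ) a (EuclideanSpace.single j d)⟫_ℂ = star c * a i j * d := by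
  rw [EuclideanSpace.inner_single_left]
  simp [mul_assoc]

/-- On matrices read as tensors, `a ⊗ bᵀ` acts as `s ↦ a s b`, and the inner product is the
Hilbert–Schmidt one. The transpose turns right multiplication into an operator on the second leg. -/
theorem Matrix.inner_toTensor_map (s a b : Matrix ι ι ℂ) :
    ⟪s.toTensor, TensorProduct.map
      (Matrix.toEuclideanCLM (𝕜 := ℂ) a : EuclideanSpace ℂ ι →ₗ[ℂ] EuclideanSpace ℂ ι)
      (Matrix.toEuclideanCLM (𝕜 := ℂ) b.transpose : EuclideanSpace ℂ ι →ₗ[ℂ] EuclideanSpace ℂ ι)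
      s.toTensor⟫_ℂ = (star s * a * s * b).trace := by
  change @inner ℂ (EuclideanSpace ℂ ι ⊗[ℂ] EuclideanSpace ℂ ι) InnerProductSpace.toInner _ _ = _
  have htmul : ∀ x x' y y' : EuclideanSpace ℂ ι,
      @inner ℂ (EuclideanSpace ℂ ι ⊗[ℂ] EuclideanSpace ℂ ι) InnerProductSpace.toInner
        (x ⊗ₜ[ℂ] y) (x' ⊗ₜ[ℂ] y') = ⟪x, x'⟫_ℂ * ⟪y, y'⟫_ℂ := fun _ _ _ _ => rfl
  simp only [toTensor, map_sum, TensorProduct.map_tmul, sum_inner, inner_sum, htmul,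
    ContinuousLinearMap.coe_coe, inner_single_toEuclideanCLM, transpose_apply, trace, diag_apply,
    mul_apply, star_apply, Finset.sum_mul, star_one, one_mul, mul_one]
  rw [Finset.sum_comm, Finset.sum_congr rfl fun j _ => Finset.sum_congr rfl fun i _ =>
    Finset.sum_comm, Finset.sum_congr rfl fun j _ => Finset.sum_comm, Finset.sum_comm]

theorem Matrix.norm_toTensor_sq (s : Matrix ι ι ℂ) :
    (‖s.toTensor‖ ^ 2 : ℂ) = (star s * s).trace := by
  have h := s.inner_toTensor_map 1 1
  rw [transpose_one, map_one, mul_one, mul_one] at h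
  rw [← h, ContinuousLinearMap.toLinearMap_one, TensorProduct.map_one, Module.End.one_apply]
  exact (inner_self_eq_norm_sq_to_K (𝕜 := ℂ) s.toTensor).symm

end MatrixDensity

/-! ### From finite dimensional traces to tensor product strategies -/

section FiniteDimensionalTrace

variable {n m : ℕ} [NeZero m] {τ : GroupCStar (FreeProdCyclic n m) →ₚ[ℂ] ℂ}

theorem IsStarProjection.transpose {ι : Type*} [Fintype ι] {a : Matrix ι ι ℂ}
    (ha : IsStarProjection a) : IsStarProjection a.transpose :=
  ⟨by rw [IsIdempotentElem, ← Matrix.transpose_mul, ha.isIdempotentElem.eq],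
    by
      have h : star a.transpose = (star a).transpose := rfl
      rw [IsSelfAdjoint, h, ha.isSelfAdjoint.star_eq]⟩

/-- The correlation of a tracial vector state of a matrix representation is a quantum correlation. -/
theorem IsTracialState.traceCorrelation_mem_Cq_of_matrix (hτ : IsTracialState τ) {d : ℕ}
    (σ : GroupCStar (FreeProdCyclic n m) →⋆ₐ[ℂ] Matrix (Fin d) (Fin d) ℂ)
    (v : EuclideanSpace ℂ (Fin d))
    (hv : ∀ a, τ a = ⟪v, Matrix.toEuclideanCLM (𝕜 := ℂ) (σ a) v⟫_ℂ) :
    traceCorrelation τ ∈ Cq n m := by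
  let φ : Matrix (Fin d) (Fin d) ℂ →ₗ[ℂ] ℂ :=
    { toFun := fun a => ⟪v, Matrix.toEuclideanCLM (𝕜 := ℂ) a v⟫_ℂ
      map_add' := fun a b => by simp
      map_smul' := fun c a => by simp }
  have hφ : ∀ a, φ (σ a) = τ a := fun a => (hv a).symm
  have hσ1 : σ 1 = 1 := _root_.map_one σ
  have hmem : ∀ a, σ a ∈ σ.range := fun a => ⟨a, rfl⟩
  obtain ⟨s, hs, hcomm, hdens⟩ := σ.range.exists_sqrt_trace_density φ
    (fun a => by
      change ⟪v, Matrix.toEuclideanCLM (𝕜 := ℂ) (star a) v⟫_ℂ =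
        star ⟪v, Matrix.toEuclideanCLM (𝕜 := ℂ) a v⟫_ℂ
      rw [map_star, ContinuousLinearMap.star_eq_adjoint, ContinuousLinearMap.adjoint_inner_right]
      exact (inner_conj_symm _ _).symm)
    (by
      rintro _ ⟨a, rfl⟩
      change 0 ≤ φ (star (σ a) * σ a)
      rw [← map_star, ← map_mul, hφ]
      exact τ.map_nonneg (star_mul_self_nonneg a))
    (by
      rintro _ ⟨a, rfl⟩ _ ⟨b, rfl⟩
      change φ (σ a * σ b) = φ (σ b * σ a)
      rw [← map_mul, ← map_mul, hφ, hφ, hτ.map_mul_comm])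
  have hτs : ∀ a, τ a = (σ a * (s * s)).trace := fun a => by
    rw [← hφ, hdens _ (hmem a)]
  refine ⟨EuclideanSpace ℂ (Fin d), inferInstance, inferInstance, inferInstance, inferInstance,
    EuclideanSpace ℂ (Fin d), inferInstance, inferInstance, inferInstance, inferInstance,
    fun x i => Matrix.toEuclideanCLM (𝕜 := ℂ) (σ (minProj x i)),
    fun y j => Matrix.toEuclideanCLM (𝕜 := ℂ) (σ (minProj y j)).transpose,
    s.toTensor, ⟨fun x i => ?_, fun x => ?_⟩, ⟨fun x i => ?_, fun x => ?_⟩, ?_,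
    fun x y i j => ?_⟩
  · exact ((isStarProjection_minProj x i).map σ).map _
  · rw [← map_sum, ← map_sum, sum_minProj, hσ1, _root_.map_one]
  · exact ((isStarProjection_minProj x i).map σ).transpose.map _
  · rw [← map_sum, ← Matrix.transpose_sum, ← map_sum, sum_minProj, hσ1, Matrix.transpose_one,
      _root_.map_one]
  · have h1 : (‖s.toTensor‖ ^ 2 : ℂ) = 1 := by
      rw [s.norm_toTensor_sq, hs.star_eq, ← hτ.map_one, hτs, hσ1, one_mul]
    have h2 : ‖s.toTensor‖ ^ 2 = 1 := by exact_mod_cast h1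
    exact (pow_eq_one_iff_of_nonneg (norm_nonneg _) two_ne_zero).1 h2
  -- As `s` commutes with the image of `σ`, `tr(s a s b) = tr(a b s²)`, which is the value of `τ`.
  · have h1 := hcomm _ (hmem (minProj x i))
    have h2 := hcomm _ (hmem (minProj y j))
    rw [Matrix.inner_toTensor_map, hτ.traceCorrelation_coe, hτs, hs.star_eq, map_mul, h1.eq,
      mul_assoc, mul_assoc, mul_assoc, ← mul_assoc s s, (h2.mul_left h2).eq]

/-- An orthonormal basis of the GNS space turns the GNS representation into a matrix representation.
-/
theorem IsTracialState.traceCorrelation_mem_Cq (hτ : IsTracialState τ)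
    (hfd : HasFiniteDimensionalGNS τ) : traceCorrelation τ ∈ Cq n m := by
  have : FiniteDimensional ℂ τ.GNS := hfd
  let U := (stdOrthonormalBasis ℂ τ.GNS).repr
  refine hτ.traceCorrelation_mem_Cq_of_matrix
    ((U.conjStarAlgEquiv.trans Matrix.toEuclideanCLM.symm).toStarAlgHom.comp τ.gnsStarAlgHom)
    (U (τ.toGNS 1)) fun a => ?_
  have h : Matrix.toEuclideanCLM (𝕜 := ℂ) ((U.conjStarAlgEquiv.trans
      Matrix.toEuclideanCLM.symm).toStarAlgHom.comp τ.gnsStarAlgHom a) =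
      U.conjStarAlgEquiv (τ.gnsStarAlgHom a) :=
    Matrix.toEuclideanCLM.apply_symm_apply _
  rw [h, LinearIsometryEquiv.conjStarAlgEquiv_apply_apply, LinearIsometryEquiv.symm_apply_apply,
    LinearIsometryEquiv.inner_map_map, ← τ.apply_eq_inner]

end FiniteDimensionalTrace

/-! ### Suprema of real sets in the order of `ℂ` -/

/-- In the order of `ℂ`, anything above a real number is real. Nonemptiness is what forces an upper
bound to be real. -/
theorem Complex.isLUB_ofReal_image {V : Set ℝ} {a : ℝ} (hV : V.Nonempty) (h : IsLUB V a) :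
    IsLUB (Complex.ofReal '' V) (a : ℂ) := by
  refine ⟨?_, fun z hz => ?_⟩
  · rintro _ ⟨v, hv, rfl⟩
    exact Complex.real_le_real.2 (h.1 hv)
  · obtain ⟨v, hv⟩ := hV
    have hzre : (z.re : ℂ) = z := (Complex.eq_re_of_ofReal_le (hz ⟨v, hv, rfl⟩)).symm
    rw [← hzre, Complex.real_le_real]
    refine h.2 fun w hw => ?_
    have := hz ⟨w, hw, rfl⟩
    rwa [← hzre, Complex.real_le_real] at this

/-! ### Compactness of the set of tracial states -/

section Compactness

variable {A : Type*} [CStarAlgebra A] [PartialOrder A] [StarOrderedRing A]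

/-- The values at `b` of the tracial states that vanish on a given set form a compact set. -/
theorem isCompact_tracialState_values (N : Set A) (b : A) :
    IsCompact {z : ℂ | ∃ τ : A →ₚ[ℂ] ℂ, IsTracialState τ ∧ (∀ a ∈ N, τ a = 0) ∧ z = τ b} := by
  -- All the conditions are pointwise and closed, and states are contractive, so Banach–Alaoglu
  -- applies.
  let K : Set (WeakDual ℂ A) :=
    {f | (∀ a, 0 ≤ a → 0 ≤ f a) ∧ f 1 = 1 ∧ (∀ a b, f (a * b) = f (b * a)) ∧ ∀ a ∈ N, f a = 0}
  have hev : ∀ a : A, Continuous fun f : WeakDual ℂ A => f a := WeakDual.eval_continuous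
  have hclosed : IsClosed K := by
    have : K = (⋂ a, ⋂ (_ : 0 ≤ a), {f : WeakDual ℂ A | 0 ≤ f a}) ∩ ({f | f 1 = 1} ∩
        ((⋂ a, ⋂ b, {f | f (a * b) = f (b * a)}) ∩ ⋂ a ∈ N, {f | f a = 0})) := by
      ext f
      simp only [K, Set.mem_ofPred_eq, Set.mem_inter_iff, Set.mem_iInter]
    rw [this]
    refine (isClosed_iInter fun a => isClosed_iInter fun _ =>
      isClosed_le continuous_const (hev a)).inter
      ((isClosed_eq (hev 1) continuous_const).inter
      ((isClosed_iInter fun a => isClosed_iInter fun b => isClosed_eq (hev _) (hev _)).inter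
      (isClosed_iInter fun a => isClosed_iInter fun _ => isClosed_eq (hev a) continuous_const)))
  have hsub : K ⊆ WeakDual.toStrongDual ⁻¹' Metric.closedBall 0 1 := by
    intro f hf
    let τ : A →ₚ[ℂ] ℂ := PositiveLinearMap.mk₀ (f : A →L[ℂ] ℂ).toLinearMap hf.1
    rw [Set.mem_preimage, mem_closedBall_zero_iff]
    refine ContinuousLinearMap.opNorm_le_bound _ zero_le_one fun a => ?_
    rw [one_mul]
    exact PositiveLinearMap.norm_apply_le (τ := τ) hf.2.1 a
  have hK : IsCompact K := (WeakDual.isCompact_closedBall 0 1).of_isClosed_subset hclosed hsub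
  convert hK.image (hev b) using 1
  ext z
  constructor
  · rintro ⟨τ, hτ, hN, rfl⟩
    refine ⟨StrongDual.toWeakDual (τ.toLinearMap.mkContinuous 1 fun a => ?_),
      ⟨fun a ha => τ.map_nonneg ha, hτ.map_one, hτ.map_mul_comm, hN⟩, rfl⟩
    rw [one_mul]
    exact PositiveLinearMap.norm_apply_le hτ.map_one a
  · rintro ⟨f, hf, rfl⟩
    exact ⟨PositiveLinearMap.mk₀ (f : A →L[ℂ] ℂ).toLinearMap hf.1, ⟨hf.2.1, hf.2.2.1⟩, hf.2.2.2,
      rfl⟩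

end Compactness

/-! ### Values of games -/

section Values

variable {n m : ℕ} [NeZero m] (G : Game n m) (Γ : InputDistribution n)

/-- The values `τ(B)` for the tracial states in a class that corresponds to the synchronous
elements of `C` are the payoffs of these elements. -/
theorem setOf_apply_gameElement_eq {C : Set (Correlation n m)}
    {Q : (GroupCStar (FreeProdCyclic n m) →ₚ[ℂ] ℂ) → Prop}
    (h1 : ∀ τ, IsTracialState τ → Q τ → traceCorrelation τ ∈ C)
    (h2 : ∀ p ∈ C, p ∈ synchronous n m → ∃ τ, IsTracialState τ ∧ Q τ ∧
      ∀ x y i j, (p x y i j : ℂ) = τ (minProj x i * minProj y j)) :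
    {z : ℂ | ∃ τ, IsTracialState τ ∧ Q τ ∧ z = τ (gameElement G Γ)} =
      Complex.ofReal '' (payoff G Γ '' (C ∩ synchronous n m)) := by
  ext z
  constructor
  · rintro ⟨τ, hτ, hQ, rfl⟩
    exact ⟨_, ⟨_, ⟨h1 τ hτ hQ, hτ.traceCorrelation_mem_synchronous⟩, rfl⟩,
      payoff_eq_apply_gameElement G Γ τ _ hτ.traceCorrelation_coe⟩
  · rintro ⟨_, ⟨p, ⟨hp, hs⟩, rfl⟩, rfl⟩
    obtain ⟨τ, hτ, hQ, hpτ⟩ := h2 p hp hs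
    exact ⟨τ, hτ, hQ, payoff_eq_apply_gameElement G Γ τ p hpτ⟩

theorem nonempty_payoff_image {C : Set (Correlation n m)}
    {Q : (GroupCStar (FreeProdCyclic n m) →ₚ[ℂ] ℂ) → Prop}
    (h0 : ∃ τ, IsTracialState τ ∧ Q τ)
    (h : {z : ℂ | ∃ τ, IsTracialState τ ∧ Q τ ∧ z = τ (gameElement G Γ)} =
      Complex.ofReal '' (payoff G Γ '' (C ∩ synchronous n m))) :
    (payoff G Γ '' (C ∩ synchronous n m)).Nonempty := by
  obtain ⟨τ, hτ, hQ⟩ := h0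
  rw [← Set.image_nonempty (f := Complex.ofReal), ← h]
  exact ⟨_, τ, hτ, hQ, rfl⟩

/-- The real `sSup` is a genuine supremum only for a nonempty bounded set: `h0` supplies a point,
and `‖B‖` bounds the values of all tracial states. -/
theorem isLUB_syncValue {C : Set (Correlation n m)}
    {Q : (GroupCStar (FreeProdCyclic n m) →ₚ[ℂ] ℂ) → Prop}
    (h0 : ∃ τ, IsTracialState τ ∧ Q τ)
    (h : {z : ℂ | ∃ τ, IsTracialState τ ∧ Q τ ∧ z = τ (gameElement G Γ)} =
      Complex.ofReal '' (payoff G Γ '' (C ∩ synchronous n m))) :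
    IsLUB {z : ℂ | ∃ τ, IsTracialState τ ∧ Q τ ∧ z = τ (gameElement G Γ)}
      (syncValue C G Γ : ℂ) := by
  have hne := nonempty_payoff_image G Γ h0 h
  have hbdd : BddAbove (payoff G Γ '' (C ∩ synchronous n m)) := by
    refine ⟨‖gameElement G Γ‖, fun v hv => ?_⟩
    have : (v : ℂ) ∈ {z : ℂ | ∃ τ, IsTracialState τ ∧ Q τ ∧ z = τ (gameElement G Γ)} :=
      h ▸ ⟨v, hv, rfl⟩
    obtain ⟨τ, hτ, -, hv⟩ := this
    have := PositiveLinearMap.norm_apply_le hτ.map_one (gameElement G Γ)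
    rw [← hv, Complex.norm_real] at this
    exact (le_abs_self v).trans this
  rw [h]
  exact Complex.isLUB_ofReal_image hne (isLUB_csSup hne hbdd)

theorem isGreatest_syncValue {C : Set (Correlation n m)}
    {Q : (GroupCStar (FreeProdCyclic n m) →ₚ[ℂ] ℂ) → Prop}
    (h0 : ∃ τ, IsTracialState τ ∧ Q τ)
    (h : {z : ℂ | ∃ τ, IsTracialState τ ∧ Q τ ∧ z = τ (gameElement G Γ)} =
      Complex.ofReal '' (payoff G Γ '' (C ∩ synchronous n m)))
    (hc : IsCompact {z : ℂ | ∃ τ, IsTracialState τ ∧ Q τ ∧ z = τ (gameElement G Γ)}) :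
    IsGreatest {z : ℂ | ∃ τ, IsTracialState τ ∧ Q τ ∧ z = τ (gameElement G Γ)}
      (syncValue C G Γ : ℂ) := by
  refine ⟨?_, (isLUB_syncValue G Γ h0 h).1⟩
  have hV : IsCompact (payoff G Γ '' (C ∩ synchronous n m)) := by
    have := hc.image Complex.continuous_re
    rwa [h, Set.image_image, Set.image_congr (g := id) (fun v _ => Complex.ofReal_re v),
      Set.image_id] at this
  have hne := nonempty_payoff_image G Γ h0 h
  rw [h]
  exact ⟨_, hV.sSup_mem hne, rfl⟩

/-- The trivial representation gives a tracial state with one-dimensional GNS representation. -/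
theorem exists_tracialState_trivial (G : Type) [Group G] : ∃ τ : GroupCStar G →ₚ[ℂ] ℂ,
    IsTracialState τ ∧ HasFiniteDimensionalGNS τ ∧ HasAbelianGNS τ := by
  let ρ : UnitaryRep G := { H := ℂ, toHom := 1 }
  let π : GroupCStar G →⋆ₐ[ℂ] (ℂ →L[ℂ] ℂ) := GroupCStar.extend ρ
  have hcomm : ∀ S T : ℂ →L[ℂ] ℂ, Commute S T := fun S T => by
    ext
    simp only [mul_apply_eq_comp]
    rw [show S (T 1) = T 1 * S 1 by rw [← smul_eq_mul, ← map_smul, smul_eq_mul, mul_one],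
      show T (S 1) = S 1 * T 1 by rw [← smul_eq_mul, ← map_smul, smul_eq_mul, mul_one], mul_comm]
  refine ⟨vectorFunctional π (1 : ℂ), ⟨?_, fun a b => ?_⟩,
    hasFiniteDimensionalGNS_vectorFunctional π 1,
    hasAbelianGNS_vectorFunctional π 1 fun a b => hcomm _ _⟩
  · rw [vectorFunctional_apply, map_one π]; simp
  · rw [vectorFunctional_apply, vectorFunctional_apply, map_mul, map_mul, (hcomm _ _).eq]

end Values

end

theorem proposition4p2 (n m : ℕ) [NeZero m] (G : Game n m) (Γ : InputDistribution n) :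
    IsGreatest
      {z : ℂ | ∃ τ : GroupCStar (FreeProdCyclic n m) →ₚ[ℂ] ℂ,
        IsTracialState τ ∧ z = τ (gameElement G Γ)}
      (syncValue (Cqc n m) G Γ : ℂ) ∧
    IsLUB
      {z : ℂ | ∃ τ : GroupCStar (FreeProdCyclic n m) →ₚ[ℂ] ℂ,
        IsTracialState τ ∧ HasFiniteDimensionalGNS τ ∧ z = τ (gameElement G Γ)}
      (syncValue (Cq n m) G Γ : ℂ) ∧
    IsGreatest
      {z : ℂ | ∃ τ : GroupCStar (FreeProdCyclic n m) →ₚ[ℂ] ℂ,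
        IsTracialState τ ∧ HasAbelianGNS τ ∧ z = τ (gameElement G Γ)}
      (syncValue (Cloc n m) G Γ : ℂ) := by
  obtain ⟨τ₀, hτ₀, hfd, hab⟩ := exists_tracialState_trivial (FreeProdCyclic n m)
  refine ⟨?_, ?_, ?_⟩
  · have h := isGreatest_syncValue G Γ (C := Cqc n m) (Q := fun _ => True) ⟨τ₀, hτ₀, trivial⟩
      (setOf_apply_gameElement_eq G Γ (fun τ hτ _ => hτ.traceCorrelation_mem_Cqc)
        fun p hp hs => by simpa using exists_tracialState_of_mem_Cqc hp hs)
      (by simpa using isCompact_tracialState_values ∅ (gameElement G Γ))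
    simpa using h
  · exact isLUB_syncValue G Γ ⟨τ₀, hτ₀, hfd⟩
      (setOf_apply_gameElement_eq G Γ (fun τ hτ hQ => hτ.traceCorrelation_mem_Cq hQ)
        fun p hp hs => exists_tracialState_of_mem_Cq hp hs)
  · refine isGreatest_syncValue G Γ ⟨τ₀, hτ₀, hab⟩
      (setOf_apply_gameElement_eq G Γ (fun τ hτ hQ => hτ.traceCorrelation_mem_Cloc hQ)
        fun p hp hs => exists_tracialState_of_mem_Cloc hp hs) ?_
    -- Commutativity of the GNS image is encoded as vanishing of `τ` on all elements `c⋆(ab - ba)d`.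
    convert isCompact_tracialState_values {e : GroupCStar (FreeProdCyclic n m) |
      ∃ a b c d, e = star c * ((a * b - b * a) * d)} (gameElement G Γ) using 7
    rw [PositiveLinearMap.hasAbelianGNS_iff]
    constructor
    · rintro h _ ⟨a, b, c, d, rfl⟩
      exact h a b c d
    · intro h a b c d
      exact h _ ⟨a, b, c, d, rfl⟩
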